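/- **Setting.** Let $\mathfrak S=A_4$ be the algebra of sedenions, obtained from $A_0=\mathbb R$ by four Cayley–Dickson doublings $A_{\ell+1}=A_\ell+A_\ell e$, with $(a+be)(c+de)=ac-\overline d\,b+(da+b\overline c)e$ and $\overline{a+be}=\overline a-be$, with its Euclidean inner product $\langle\cdot,\cdot\rangle$ and norm $|\cdot|$. Let $L_s$ be left multiplication by $s$, and let $\mathcal C=\{s\in\mathfrak S: L_s^2=-\mathrm{id}\}$ be the set of slice units; elements of $\mathcal C$, and of the slices $\mathbb C_I=\mathbb R+\mathbb RI$, act on $\mathfrak S$ by left multiplication, and products of them are compositions of these operators. For $I\in\mathcal C$ let $\Psi^I(x+iy)=x+yI$. The slice cone is $\mathcal W=\bigcup_{I\in\mathcal C}\mathbb C_I$, with the slice topology $\tau_s$: $\Omega\subset\mathcal W$ is open if and only if $\Omega\cap\mathbb C_I$ is open in $\mathbb C_I$ for all $I\in\mathcal C$. A function $f$ on a set $\Omega\in\tau_s$ is slice regular if for every $I\in\mathcal C$ its restriction to $\Omega\cap\mathbb C_I$ is real differentiable and $\tfrac12(\partial_x+I\partial_y)f(x+yI)=0$ there. Fix $I_0\in\mathcal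 C$. For $p\in\mathcal W$ let $\mathrm{Re}\,p=\langle p,1\rangle$; $I_p=I_0$ if $p\in\mathbb R$ and $I_p=\frac{p-\mathrm{Re}\,p}{|p-\mathrm{Re}\,p|}$ otherwise; $\mathrm{Im}\,p=\langle p,I_p\rangle$; $z_p=\mathrm{Re}\,p+i\,\mathrm{Im}\,p\in\mathbb C$. For a tuple $J=(J_1,\dots,J_m)$ in $\mathcal C$ let $$\mathcal C^{\ker}(J)=\Big\{I\in\mathcal C:\ \ker(1,I)\supset\bigcap_{\ell}\ker(1,J_\ell)\Big\},\qquad \ker(1,I)=\{(a,b)\in\mathfrak S^2:a+Ib=0\}.$$ $J$ is a slice-solution if $\mathcal C^{\ker}(J)=\mathcal C$, and a hyper-solution if it is not a slice-solution but $(J_1,\dots,J_m,I)$ is one for every $I\in\mathcal C\setminus\mathcal C^{\ker}(J)$. For $r\in[0,\infty]$ let $B^*(z,r)=\{w\in\mathbb C:|w-z|<r\}\cup\{z\}$ and $$\Sigma(p,r)=\bigcup_{K\in\mathcal C}\Psi^K\big[B^*(z_p,r)\cap B^*(\overline{z_p},r)\big]\ \cup\ \Psi^{I_p}[B^*(z_p,r)],$$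 $$\Sigma(p,r,J)=\bigcup_{K\in\mathcal C}\Psi^K\big[B^*(z_p,r)\cap B^*(\overline{z_p},r)\big]\ \cup\bigcup_{K\in\mathcal C^{\ker}(J)}\Psi^{K}[B^*(z_p,r)]$$ (the $\sigma$-ball and, if $r>0$ and $J$ is a hyper-solution with $J_1=I_p$, the hyper-$\sigma$-ball). For $a=(a_\ell)_{\ell\in\mathbb N}$ in $\mathfrak S$ put $R_a=1/\limsup_\ell|a_\ell|^{1/\ell}$ (with $1/0=\infty$, $1/\infty=0$). For $J\in\mathcal C$ put $R_a^{p,J}=R_a$ if $p\in\mathbb R$ or $J=I_p$, and $R_a^{p,J}=1/\limsup_\ell \mathrm{dist}(a_\ell,\ker(I_p-J))^{1/\ell}$ otherwise, where $\ker(I_p-J)=\{c\in\mathfrak S:(I_p-J)c=0\}$. Put $R_a^p=\sup_{K\in\mathcal C}R_a^{p,K}$. For $J\in\mathcal C$ with $R_a^{p,J}=R_a^p$ let $$\Sigma(p,a)=\begin{cases}\{q\in\mathcal W:|q-p|<R_a\}\cup\{p\},& p\in\mathbb R,\\ \Sigma(p,R_a^p),& p\notin\mathbb R,\ R_a^p=R_a,\\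 \Sigma(p,R_a,(I_p,J))\cap\Sigma(p,R_a^p),&\text{otherwise,}\end{cases}$$ and for $0<\varepsilon<R_a$ let $\Sigma(p,a,\varepsilon)$ be the set given by the same formula with the radii $R_a,R_a^p$ of the balls replaced by $R_a-\varepsilon$, $R_a^p-\varepsilon$ (with the same case distinction). Finally $(q-p)^{*\ell}$ is the $\ell$-th power of $q-p$ for the $*$-product of polynomials in $q$ (the Cauchy product of right coefficients), so that $(q-p)^{*\ell}a_\ell=\sum_{k=0}^{\ell}\binom{\ell}{k}q^{\ell-k}\big((-p)^ka_\ell\big)$. **Theorem.** Let $I_0\in\mathcal C$, $p\in\mathcal W$ and $a_\ell\in\mathfrak S$ ($\ell\in\mathbb N$). There is $J\in\mathcal C$ with $R_a^{p,J}=R_a^p$, and for every such $J$ the following hold for $P(q)=\sum_{\ell\in\mathbb N}(q-p)^{*\ell}a_\ell$. 1. If $R_a<R_a^p$, then $(I_p,J)$ is a hyper-solution. 2. The series converges absolutely at every point of $\Sigma(p,a)$. 3. If $R_a>0$, then $\Sigma(p,a)$ is open in the slice topology and $P$ is slice regular on it. 4. The series diverges (its partial sums do not converge) at every point of the exterior of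 $\Sigma(p,a)$ in the slice topology, except possibly, if $R_a<R_a^p$ and $R_a+R_a^p=2\,\mathrm{Im}\,p$, at the points $\mathrm{Re}\,p+(\mathrm{Im}\,p-R_a)K$ with $K\in\mathcal C^{\ker}(I_p,J)$. 5. If $R_a\in(0,+\infty]$ and $\varepsilon\in(0,R_a)$, then the series converges uniformly on the closure, in the slice topology, of $\Sigma(p,\varepsilon)$ if $R_a=+\infty$, and of $\Sigma(p,a,\varepsilon)$ if $R_a<+\infty$. -/

import Mathlib

open Filter Topology
open scoped ENNReal Polynomial

namespace SedenionSeries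

/-! ### The Cayley-Dickson construction -/

/-- The Cayley-Dickson double `A + A e` of `A`, an element `a + b e` being the pair `(a, b)`.
It carries the Euclidean (`ℓ²`) norm and inner product of pairs. -/
def CD (A : Type) : Type := WithLp 2 (A × A)

namespace CD

variable {A : Type}

/-- The element `a + b e`. -/
def mk (a b : A) : CD A := WithLp.toLp 2 (a, b)

/-- The component `a` of `a + b e`. -/
def left (x : CD A) : A := (WithLp.ofLp x).1

/-- The component `b` of `a + b e`. -/
def right (x : CD A) : A := (WithLp.ofLp x).2

noncomputable instance [NormedAddCommGroup A] : NormedAddCommGroup (CD A) :=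
  inferInstanceAs (NormedAddCommGroup (WithLp 2 (A × A)))

noncomputable instance [NormedAddCommGroup A] [InnerProductSpace ℝ A] :
    InnerProductSpace ℝ (CD A) :=
  inferInstanceAs (InnerProductSpace ℝ (WithLp 2 (A × A)))

/-- The conjugate of `a + b e` is `conj a - b e`. -/
instance [Star A] [Neg A] : Star (CD A) := ⟨fun x => mk (star x.left) (-x.right)⟩

/-- `(a + b e) (c + d e) = a c - (conj d) b + (d a + b (conj c)) e`. -/
instance [Mul A] [Add A] [Sub A] [Star A] : Mul (CD A) :=
  ⟨fun x y => mk (x.left * y.left - star y.right * x.right)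
    (y.right * x.left + x.right * star y.left)⟩

instance [One A] [Zero A] : One (CD A) := ⟨mk 1 0⟩

/-- Bilinearity of the product and linearity of the conjugation. -/
class IsBilin (A : Type) [NormedAddCommGroup A] [InnerProductSpace ℝ A] [Mul A] [Star A] :
    Prop where
  left_distrib : ∀ x y z : A, x * (y + z) = x * y + x * z
  right_distrib : ∀ x y z : A, (x + y) * z = x * z + y * z
  smul_mul : ∀ (r : ℝ) (x y : A), (r • x) * y = r • (x * y)
  mul_smul : ∀ (r : ℝ) (x y : A), x * (r • y) = r • (x * y)
  star_add : ∀ x y : A, star (x + y) = star x + star y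
  star_smul : ∀ (r : ℝ) (x : A), star (r • x) = r • star x

instance : IsBilin ℝ where
  left_distrib := mul_add
  right_distrib := add_mul
  smul_mul r x y := by simp [mul_assoc]
  mul_smul r x y := by simp [mul_left_comm]
  star_add := by simp
  star_smul := by simp

theorem mk_add [NormedAddCommGroup A] (a b c d : A) :
    mk a b + mk c d = mk (a + c) (b + d) := rfl

theorem smul_mk [NormedAddCommGroup A] [InnerProductSpace ℝ A] (r : ℝ) (a b : A) :
    r • mk a b = mk (r • a) (r • b) := rfl

instance [NormedAddCommGroup A] [InnerProductSpace ℝ A] [Mul A] [Star A] [h : IsBilin A] :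
    IsBilin (CD A) where
  left_distrib x y z := by
    change mk _ _ = mk _ _ + mk _ _
    rw [mk_add]
    change mk (x.left * (y.left + z.left) - star (y.right + z.right) * x.right)
      ((y.right + z.right) * x.left + x.right * star (y.left + z.left)) = _
    simp only [h.left_distrib, h.right_distrib, h.star_add]
    congr 1 <;> abel
  right_distrib x y z := by
    change mk _ _ = mk _ _ + mk _ _
    rw [mk_add]
    change mk ((x.left + y.left) * z.left - star z.right * (x.right + y.right))
      (z.right * (x.left + y.left) + (x.right + y.right) * star z.left) = _
    simp only [h.left_distrib, h.right_distrib]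
    congr 1 <;> abel
  smul_mul r x y := by
    change mk _ _ = r • mk _ _
    rw [smul_mk]
    change mk ((r • x.left) * y.left - star y.right * (r • x.right))
      (y.right * (r • x.left) + (r • x.right) * star y.left) = _
    simp only [h.smul_mul, h.mul_smul, smul_sub, smul_add]
  mul_smul r x y := by
    change mk _ _ = r • mk _ _
    rw [smul_mk]
    change mk (x.left * (r • y.left) - star (r • y.right) * x.right)
      ((r • y.right) * x.left + x.right * star (r • y.left)) = _
    simp only [h.smul_mul, h.mul_smul, h.star_smul, smul_sub, smul_add]
  star_add x y := by
    change mk (star (x.left + y.left)) (-(x.right + y.right)) = mk _ _ + mk _ _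
    rw [mk_add, h.star_add, neg_add]
  star_smul r x := by
    change mk (star (r • x.left)) (-(r • x.right)) = r • mk _ _
    rw [smul_mk, h.star_smul, smul_neg]

end CD

/-- The sedenions, the fourth Cayley-Dickson algebra over the reals. -/
abbrev Sedenion : Type := CD (CD (CD (CD ℝ)))

/-- Left multiplication `L_s : x ↦ s x`. -/
noncomputable def L (s : Sedenion) : Module.End ℝ Sedenion where
  toFun x := s * x
  map_add' := CD.IsBilin.left_distrib s
  map_smul' r x := CD.IsBilin.mul_smul r s x

/-! ### Slice units, the slice cone and its topology -/

/-- The slice units: the sedenions `s` with `L_s² = -id`. Since `s = L_s 1`, the map `s ↦ L_s` is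
injective, and a slice unit `s` is identified with the complex structure `L_s`. -/
def sliceUnits : Set Sedenion := {s | L s * L s = -1}

/-- `Ψ I (x + i y) = x + y I`, an element of the slice `ℂ_I`. -/
noncomputable def Ψ (I : Sedenion) (z : ℂ) : Sedenion := z.re • (1 : Sedenion) + z.im • I

/-- The slice cone, the union of the slices `ℂ_I`. -/
def SliceCone : Type := {q : Sedenion // ∃ I ∈ sliceUnits, ∃ z : ℂ, q = Ψ I z}

instance : Coe SliceCone Sedenion := ⟨Subtype.val⟩

/-- `Ψ I` as a map into the slice cone. -/
noncomputable def toCone (I : sliceUnits) (z : ℂ) : SliceCone :=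
  ⟨Ψ I.1 z, I.1, I.2, z, rfl⟩

/-- The slice topology: `Ω` is open when its intersection with every slice `ℂ_I ≅ ℂ` is open. -/
instance : TopologicalSpace SliceCone where
  IsOpen Ω := ∀ I : sliceUnits, IsOpen {z : ℂ | toCone I z ∈ Ω}
  isOpen_univ _ := isOpen_univ
  isOpen_inter _ _ h₁ h₂ I := (h₁ I).inter (h₂ I)
  isOpen_sUnion S h I := by
    have : {z : ℂ | toCone I z ∈ ⋃₀ S} = ⋃ Ω ∈ S, {z : ℂ | toCone I z ∈ Ω} := by
      ext z; simp
    rw [this]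
    exact isOpen_biUnion fun Ω hΩ => h Ω hΩ I

/-- The trace on the slice cone of a set of sedenions. -/
def onCone (S : Set Sedenion) : Set SliceCone := {q | (q : Sedenion) ∈ S}

/-- Slice regularity on `Ω`: `Ω` is open in the slice topology and, on every slice, `f` is real
differentiable with `(1 / 2) (∂/∂x + I ∂/∂y) f (x + y I) = 0`. -/
def SliceRegularOn (f : SliceCone → Sedenion) (Ω : Set SliceCone) : Prop :=
  IsOpen Ω ∧ ∀ (I : sliceUnits) (z : ℂ), toCone I z ∈ Ω →
    DifferentiableAt ℝ (fun w : ℂ => f (toCone I w)) z ∧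
      (1 / 2 : ℝ) • (fderiv ℝ (fun w : ℂ => f (toCone I w)) z 1 +
        L I.1 (fderiv ℝ (fun w : ℂ => f (toCone I w)) z Complex.I)) = 0

/-! ### Star powers and the power series -/

/-- The value at `q` of the polynomial `∑ qⁿ cₙ` in the variable `q`, with coefficients (acting
on sedenions) on the right. Multiplication of polynomials, the Cauchy product of the coefficients,
is the `*`-product. -/
noncomputable def starEval (f : (Module.End ℝ Sedenion)[X]) (q : Sedenion) :
    Module.End ℝ Sedenion :=
  f.sum fun n c => L q ^ n * c

/-- The `*`-power `(q - p)^{*n}`. -/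
noncomputable def starPow (p : Sedenion) (n : ℕ) (q : Sedenion) : Module.End ℝ Sedenion :=
  starEval ((Polynomial.X - Polynomial.C (L p)) ^ n) q

/-- The term `(q - p)^{*n} aₙ`. -/
noncomputable def term (p : SliceCone) (a : ℕ → Sedenion) (n : ℕ) (q : SliceCone) : Sedenion :=
  starPow p n q (a n)

/-- The partial sum of the first `N` terms. -/
noncomputable def partialSum (p : SliceCone) (a : ℕ → Sedenion) (N : ℕ) (q : SliceCone) :
    Sedenion :=
  ∑ n ∈ Finset.range N, term p a n q

/-- The sum `P(q) = ∑ (q - p)^{*n} aₙ` (meaningful where the series converges absolutely). -/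
noncomputable def P (p : SliceCone) (a : ℕ → Sedenion) (q : SliceCone) : Sedenion :=
  ∑' n, term p a n q

/-! ### Coordinates of a point, with respect to a slice unit `I₀` used at real points -/

/-- The point is a real number. -/
def IsRealPt (p : Sedenion) : Prop := ∃ x : ℝ, p = x • (1 : Sedenion)

/-- The real part `⟨p, 1⟩`. -/
noncomputable def rePt (p : Sedenion) : ℝ := inner ℝ p 1

open Classical in
/-- `I_p`: the normalized imaginary part of `p`, and `I₀` if `p` is real. -/
noncomputable def unitPt (I₀ p : Sedenion) : Sedenion :=
  if IsRealPt p then I₀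
  else ‖p - rePt p • (1 : Sedenion)‖⁻¹ • (p - rePt p • (1 : Sedenion))

/-- The imaginary part `⟨p, I_p⟩`. -/
noncomputable def imPt (I₀ p : Sedenion) : ℝ := inner ℝ p (unitPt I₀ p)

/-- `z_p = Re p + i Im p`. -/
noncomputable def zPt (I₀ p : Sedenion) : ℂ := ⟨rePt p, imPt I₀ p⟩

/-! ### Hyper-solutions -/

/-- `ker (1, I)`, the pairs `(a, b)` with `a + I b = 0`. -/
def kerOne (I : Sedenion) : Set (Sedenion × Sedenion) := {v | v.1 + L I v.2 = 0}

/-- The slice units `I` with `ker (1, I) ⊇ ⋂ ker (1, J_ℓ)`. -/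
def unitsKer {m : ℕ} (J : Fin m → Sedenion) : Set Sedenion :=
  {I | I ∈ sliceUnits ∧ (⋂ l, kerOne (J l)) ⊆ kerOne I}

/-- Slice-solutions. -/
def IsSliceSolution {m : ℕ} (J : Fin m → Sedenion) : Prop :=
  (∀ l, J l ∈ sliceUnits) ∧ unitsKer J = sliceUnits

/-- Hyper-solutions. -/
def IsHyperSolution {m : ℕ} (J : Fin m → Sedenion) : Prop :=
  (∀ l, J l ∈ sliceUnits) ∧ ¬ IsSliceSolution J ∧
    ∀ I ∈ sliceUnits \ unitsKer J, IsSliceSolution (Fin.snoc J I : Fin (m + 1) → Sedenion)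

/-! ### Balls -/

/-- `B*(z, r) = {w : |w - z| < r} ∪ {z}`. -/
def ballStar (z : ℂ) (r : ℝ≥0∞) : Set ℂ := {w | edist w z < r} ∪ {z}

/-- The ball `{q : |q - p| < r} ∪ {p}` of the slice cone. -/
def coneBall (p : Sedenion) (r : ℝ≥0∞) : Set SliceCone :=
  onCone ({q | edist q p < r} ∪ {p})

/-- `Σ(p, r)`, the `σ`-ball. -/
noncomputable def sigmaBall (I₀ p : Sedenion) (r : ℝ≥0∞) : Set SliceCone :=
  onCone ((⋃ K ∈ sliceUnits,
      Ψ K '' (ballStar (zPt I₀ p) r ∩ ballStar (starRingEnd ℂ (zPt I₀ p)) r)) ∪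
    Ψ (unitPt I₀ p) '' ballStar (zPt I₀ p) r)

/-- `Σ(p, r, J)`, the hyper-`σ`-ball. -/
noncomputable def hyperSigmaBall {m : ℕ} (I₀ p : Sedenion) (r : ℝ≥0∞) (J : Fin m → Sedenion) :
    Set SliceCone :=
  onCone ((⋃ K ∈ sliceUnits,
      Ψ K '' (ballStar (zPt I₀ p) r ∩ ballStar (starRingEnd ℂ (zPt I₀ p)) r)) ∪
    ⋃ K ∈ unitsKer J, Ψ K '' ballStar (zPt I₀ p) r)

/-! ### Convergence radii -/

/-- `R_a = 1 / limsup |aₙ|^{1/n}`, with `1 / 0 = ∞` and `1 / ∞ = 0`. -/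
noncomputable def radius (a : ℕ → Sedenion) : ℝ≥0∞ :=
  (limsup (fun n : ℕ => ENNReal.ofReal (‖a n‖ ^ (1 / (n : ℝ)))) atTop)⁻¹

open Classical in
/-- `R_a^{p, J}`, which is `R_a` if `p` is real or `J = I_p`, and otherwise
`1 / limsup dist(aₙ, ker(I_p - J))^{1/n}`. -/
noncomputable def radiusAt (I₀ p : Sedenion) (a : ℕ → Sedenion) (J : Sedenion) : ℝ≥0∞ :=
  if IsRealPt p ∨ J = unitPt I₀ p then radius a
  else (limsup (fun n : ℕ => ENNReal.ofReal
    (Metric.infDist (a n) {c | (unitPt I₀ p - J) * c = 0} ^ (1 / (n : ℝ)))) atTop)⁻¹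

/-- `R_a^p`, the supremum of the `R_a^{p, K}`. -/
noncomputable def radiusSup (I₀ p : Sedenion) (a : ℕ → Sedenion) : ℝ≥0∞ :=
  ⨆ K ∈ sliceUnits, radiusAt I₀ p a K

/-! ### The domain of convergence -/

open Classical in
/-- `Σ(p, a)`, where `J` is a slice unit with `R_a^{p, J} = R_a^p`. -/
noncomputable def sigmaDomain (I₀ p : Sedenion) (a : ℕ → Sedenion) (J : Sedenion) :
    Set SliceCone :=
  if IsRealPt p then coneBall p (radius a)
  else if radiusSup I₀ p a = radius a then sigmaBall I₀ p (radiusSup I₀ p a)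
  else hyperSigmaBall I₀ p (radius a) ![unitPt I₀ p, J] ∩ sigmaBall I₀ p (radiusSup I₀ p a)

open Classical in
/-- `Σ(p, a, ε)`, where `J` is a slice unit with `R_a^{p, J} = R_a^p`, for `ε < R_a`. -/
noncomputable def sigmaShrunk (I₀ p : Sedenion) (a : ℕ → Sedenion) (J : Sedenion) (ε : ℝ≥0∞) :
    Set SliceCone :=
  if IsRealPt p then coneBall p (radius a - ε)
  else if radiusSup I₀ p a = radius a then sigmaBall I₀ p (radiusSup I₀ p a - ε)
  else hyperSigmaBall I₀ p (radius a - ε) ![unitPt I₀ p, J] ∩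
    sigmaBall I₀ p (radiusSup I₀ p a - ε)

/-- The points of external tangency of the discs of radii `R_a < R_a^p` about `z_p` and its
conjugate: when `R_a + R_a^p = 2 Im p`, the points `Re p + (Im p - R_a) K`, where `K` is a slice
unit in the ker-set of `(I_p, J)`. At these points, which are on both boundary circles, the series
may converge or diverge. Otherwise there are no such points. -/
def tangencyPoints (I₀ p : Sedenion) (a : ℕ → Sedenion) (J : Sedenion) : Set SliceCone :=
  {q | radius a < radiusSup I₀ p a ∧
    radius a + radiusSup I₀ p a = ENNReal.ofReal (2 * imPt I₀ p) ∧
    ∃ K ∈ unitsKer ![unitPt I₀ p, J],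
      (q : Sedenion) = Ψ K ⟨rePt p, imPt I₀ p - (radius a).toReal⟩}

end SedenionSeries

/-!
The proof rests on one algebraic fact about the sedenions and one analytic decomposition.

**Algebra.** Conjugation and inner product make left and right multiplications by an imaginary
element skew-adjoint, at every stage of the Cayley-Dickson process (`CD.IsConj`). For slice units
`I ≠ J`, the space `agree I J = ker (I - J)` is described by octonions (`zero_divisor`): if
`I - J = A + B e` has a nonzero annihilator, then `A` and `B` are imaginary, orthogonal and of the
same norm, and the annihilator consists of the `c + d e` with `c = g d`, where `g = |A|⁻² A B`, and
`d` orthogonal to `1`, `A`, `B` and `g`. The two components of a slice unit span, up to a multiple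
of `e`, one imaginary line, say that of `u` for `I`; then `u` lies in the plane of `A` and `B`, which
is therefore spanned by `u` and `g u`. So `ker (I - J)` is determined by `I` and by `g`, and `g` by any
nonzero element of it: for `J, K ≠ I`, the spaces `ker (I - J)` and `ker (I - K)` are equal or meet in
`0` only (`agree_eq_or_disjoint`). This gives the hyper-solutions, and since `|v|` is bounded by the
sum of the distances of `v` to two subspaces meeting in `0`, the radii `R_a^{p,K}` take no values
besides `R_a` and `R_a^p` (`large_radius`, `exists_radiusAt_eq_radiusSup`).

**Analysis.** With `I = I_p`, `z = z_p`, the term of degree `n` at the point `Ψ^K w` is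
`½ (1 - K I) (w - z)ⁿ aₙ + ½ (1 + K I) (conj w - z)ⁿ aₙ`, where complex numbers act through `I`
(`starPow_eq`). The operator `1 + K I` vanishes exactly on `ker (I - K)`, so in the second part `aₙ`
may be replaced by its component orthogonal to that space (`perp`). Hence the series converges, to a
function which is holomorphic on the slice of `K`, if `|w - z| < R_a` and `|conj w - z|` is less than
the radius of the sequence `perp I K aₙ` (`summable_term`, `regularAt_P`). Conversely, the part of the
term in `ker (I - K)` and the part orthogonal to it are bounded separately by the term; as
`|w - z| < |conj w - z|` in the upper half plane, boundedness of the terms gives the corresponding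
non-strict inequalities (`le_radius_of_bounded`).

For real `p` one may take `I = K`, and the series is an ordinary power series on every slice. For
other `p`, by the dichotomy of the radii, the points satisfying the strict inequalities are, up to
the centre, exactly those of `Σ(p, a)` (`mem_sigmaDomain_iff`). Let `R_a > 0`. If the two discs meet,
the closed inequalities describe the closure of their intersection; if only the closed discs
meet, then they are tangent, which accounts for the exceptional points. Uniform convergence is the
Weierstrass test; the bounds extend to the closure because the terms are continuous in the slice
topology.
-/

namespace SedenionSeries

/-! ### Conjugation and inner product on Cayley-Dickson algebras -/

namespace CD

/-- The properties of unit, conjugation and Euclidean inner product which pass from `A` to its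
Cayley-Dickson double. The adjoint of a left or right multiplication is the multiplication by the
conjugate. -/
class IsConj (A : Type) [NormedAddCommGroup A] [InnerProductSpace ℝ A] [Mul A] [Star A] [One A] :
    Prop extends IsBilin A where
  one_mul : ∀ x : A, 1 * x = x
  mul_one : ∀ x : A, x * 1 = x
  star_star : ∀ x : A, star (star x) = x
  star_mul : ∀ x y : A, star (x * y) = star y * star x
  inner_one_one : inner ℝ (1 : A) 1 = 1
  star_eq : ∀ x : A, star x = (2 * inner ℝ x 1) • (1 : A) - x
  mul_star : ∀ x : A, x * star x = (inner ℝ x x) • (1 : A)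
  star_mul_self : ∀ x : A, star x * x = (inner ℝ x x) • (1 : A)
  inner_star : ∀ x y : A, inner ℝ (star x) (star y) = inner ℝ x y
  inner_mul_left : ∀ x y z : A, inner ℝ (x * y) z = inner ℝ y (star x * z)
  inner_mul_right : ∀ x y z : A, inner ℝ (x * y) z = inner ℝ x (z * star y)

instance : IsConj ℝ where
  one_mul := by simp
  mul_one := by simp
  star_star := by simp
  star_mul := by simp [mul_comm]
  inner_one_one := by simp
  star_eq x := by simp; ring
  mul_star x := by simp [sq]
  star_mul_self x := by simp [sq]
  inner_star := by simp
  inner_mul_left x y z := by simp; ring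
  inner_mul_right x y z := by simp; ring

section components

variable {A : Type}

theorem ext_components {x y : CD A} (h₁ : x.left = y.left) (h₂ : x.right = y.right) : x = y := by
  change mk x.left x.right = mk y.left y.right
  rw [h₁, h₂]

@[simp] theorem left_mk (a b : A) : (mk a b).left = a := rfl

@[simp] theorem right_mk (a b : A) : (mk a b).right = b := rfl

@[simp] theorem left_one [One A] [Zero A] : (1 : CD A).left = 1 := rfl

@[simp] theorem right_one [One A] [Zero A] : (1 : CD A).right = 0 := rfl

@[simp] theorem left_star [Star A] [Neg A] (x : CD A) : (star x).left = star x.left := rfl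

@[simp] theorem right_star [Star A] [Neg A] (x : CD A) : (star x).right = -x.right := rfl

@[simp] theorem left_mul [Mul A] [Add A] [Sub A] [Star A] (x y : CD A) :
    (x * y).left = x.left * y.left - star y.right * x.right := rfl

@[simp] theorem right_mul [Mul A] [Add A] [Sub A] [Star A] (x y : CD A) :
    (x * y).right = y.right * x.left + x.right * star y.left := rfl

variable [NormedAddCommGroup A]

@[simp] theorem left_add (x y : CD A) : (x + y).left = x.left + y.left := rfl

@[simp] theorem right_add (x y : CD A) : (x + y).right = x.right + y.right := rfl

@[simp] theorem left_sub (x y : CD A) : (x - y).left = x.left - y.left := rfl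

@[simp] theorem right_sub (x y : CD A) : (x - y).right = x.right - y.right := rfl

@[simp] theorem left_neg (x : CD A) : (-x).left = -x.left := rfl

@[simp] theorem right_neg (x : CD A) : (-x).right = -x.right := rfl

@[simp] theorem left_zero : (0 : CD A).left = 0 := rfl

@[simp] theorem right_zero : (0 : CD A).right = 0 := rfl

variable [InnerProductSpace ℝ A]

@[simp] theorem left_smul (r : ℝ) (x : CD A) : (r • x).left = r • x.left := rfl

@[simp] theorem right_smul (r : ℝ) (x : CD A) : (r • x).right = r • x.right := rfl

theorem inner_eq (x y : CD A) :
    inner ℝ x y = inner ℝ x.left y.left + inner ℝ x.right y.right :=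
  WithLp.prod_inner_apply _ _

end components

section bilin

variable {A : Type} [NormedAddCommGroup A] [InnerProductSpace ℝ A] [Mul A] [Star A] [h : IsBilin A]

theorem mul_neg' (x y : A) : x * -y = -(x * y) := by
  have := h.mul_smul (-1) x y
  simpa using this

theorem neg_mul' (x y : A) : -x * y = -(x * y) := by
  have := h.smul_mul (-1) x y
  simpa using this

theorem mul_zero' (x : A) : x * 0 = 0 := by
  have := h.mul_smul 0 x 0
  simpa using this

theorem zero_mul' (x : A) : 0 * x = 0 := by
  have := h.smul_mul 0 0 x
  simpa using this

theorem mul_sub' (x y z : A) : x * (y - z) = x * y - x * z := by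
  rw [sub_eq_add_neg, h.left_distrib, mul_neg', sub_eq_add_neg]

theorem sub_mul' (x y z : A) : (x - y) * z = x * z - y * z := by
  rw [sub_eq_add_neg, h.right_distrib, neg_mul', sub_eq_add_neg]

theorem star_neg' (x : A) : star (-x) = -star x := by
  have := h.star_smul (-1) x
  simpa using this

theorem star_sub' (x y : A) : star (x - y) = star x - star y := by
  rw [sub_eq_add_neg, h.star_add, star_neg', sub_eq_add_neg]

theorem star_zero' : star (0 : A) = 0 := by
  have := h.star_smul 0 0
  simpa using this

end bilin

section conj

variable {A : Type} [NormedAddCommGroup A] [InnerProductSpace ℝ A] [Mul A] [Star A] [One A]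
  [h : IsConj A]

theorem star_one' : star (1 : A) = 1 := by
  rw [h.star_eq, h.inner_one_one]
  module

instance : IsConj (CD A) where
  one_mul x := ext_components (by simp [h.one_mul, mul_zero']) (by simp [h.mul_one, zero_mul'])
  mul_one x := ext_components (by simp [h.mul_one, star_zero', zero_mul'])
    (by simp [star_one', zero_mul', h.mul_one])
  star_star x := ext_components (by simp [h.star_star]) (by simp)
  star_mul x y := ext_components
    (by simp [h.star_mul, star_sub', star_neg', neg_mul', mul_neg', h.star_star])
    (by simp [h.star_star, neg_mul', add_comm])
  inner_one_one := by
    rw [inner_eq, left_one, right_one, h.inner_one_one, inner_zero_left, add_zero]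
  star_eq x := ext_components (by simp [inner_eq, h.star_eq x.left]) (by simp)
  mul_star x := ext_components
    (by rw [inner_eq, add_smul]; simp [h.mul_star, star_neg', neg_mul', h.star_mul_self])
    (by simp [h.star_star, neg_mul'])
  star_mul_self x := ext_components
    (by rw [inner_eq, add_smul]; simp [mul_neg', h.star_mul_self])
    (by simp [neg_mul'])
  inner_star x y := by simp [inner_eq, h.inner_star]
  inner_mul_left x y z := by
    simp only [inner_eq, left_mul, right_mul, left_star, right_star, mul_neg', inner_sub_left,
      inner_add_left, inner_add_right, neg_mul', inner_neg_right, sub_neg_eq_add]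
    have e₁ := h.inner_mul_left x.left y.left z.left
    have e₂ : inner ℝ (star y.right * x.right) z.left = inner ℝ y.right (x.right * star z.left) := by
      rw [h.inner_mul_right, ← h.inner_star, h.star_star, h.star_mul, h.star_star]
    have e₃ := h.inner_mul_right y.right x.left z.right
    have e₄ : inner ℝ (x.right * star y.left) z.right = inner ℝ y.left (star z.right * x.right) := by
      rw [h.inner_mul_left, ← h.inner_star, h.star_star, h.star_mul, h.star_star]
    linarith
  inner_mul_right x y z := by
    simp only [inner_eq, left_mul, right_mul, left_star, right_star, inner_sub_left,
      inner_add_left, inner_add_right, neg_mul', inner_neg_right, sub_neg_eq_add,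
      h.star_star, star_neg']
    have e₁ := h.inner_mul_right x.left y.left z.left
    have e₂ : inner ℝ (star y.right * x.right) z.left = inner ℝ x.right (y.right * z.left) := by
      rw [h.inner_mul_left, h.star_star]
    have e₃ : inner ℝ (y.right * x.left) z.right = inner ℝ x.left (star y.right * z.right) :=
      h.inner_mul_left _ _ _
    have e₄ : inner ℝ (x.right * star y.left) z.right = inner ℝ x.right (z.right * y.left) := by
      rw [h.inner_mul_right, h.star_star]
    linarith

theorem inner_imag_mul {x : A} (hx : star x = -x) (y z : A) :
    inner ℝ (x * y) z = -inner ℝ y (x * z) := by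
  rw [h.inner_mul_left, hx, neg_mul', inner_neg_right]

theorem inner_mul_imag {x : A} (hx : star x = -x) (y z : A) :
    inner ℝ (y * x) z = -inner ℝ y (z * x) := by
  rw [h.inner_mul_right, hx, mul_neg', inner_neg_right]

theorem star_eq_neg_iff {x : A} : star x = -x ↔ inner ℝ x 1 = 0 := by
  rw [h.star_eq]
  constructor
  · intro hx
    have h2 : (2 * inner ℝ x 1) • (1 : A) = 0 := by
      linear_combination (norm := module) hx
    have h3 := congrArg (fun y => inner ℝ y (1 : A)) h2
    simp only [inner_smul_left, h.inner_one_one, inner_zero_left] at h3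
    simpa using h3
  · intro hx
    rw [hx]; module

/-- Orthogonal imaginary elements anticommute. -/
theorem anticomm {x y : A} (hx : star x = -x) (hy : star y = -y) (hxy : inner ℝ x y = 0) :
    x * y = -(y * x) := by
  have h1 : star (x * y) = y * x := by
    rw [h.star_mul, hx, hy, neg_mul', mul_neg', neg_neg]
  have h2 : star (x * y) = -(x * y) := by
    rw [star_eq_neg_iff, h.inner_mul_right, hy, mul_neg', h.one_mul, inner_neg_right, hxy, neg_zero]
  rw [← h1, h2, neg_neg]

end conj

end CD

/-! ### Octonions -/

/-- The octonions, the third Cayley-Dickson algebra over the reals. -/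
abbrev Octonion : Type := CD (CD (CD ℝ))

namespace Octonion

open CD

/-- The octonions are left alternative. -/
theorem star_mul_mul (x y : Octonion) : star x * (x * y) = (inner ℝ x x : ℝ) • y := by
  simp only [CD.inner_eq]
  refine ext_components (ext_components (ext_components ?_ ?_) (ext_components ?_ ?_))
    (ext_components (ext_components ?_ ?_) (ext_components ?_ ?_)) <;>
  · simp only [left_mul, right_mul, left_star, right_star, left_smul, right_smul, left_neg,
      right_neg, left_add, right_add, left_sub, right_sub, star_trivial, smul_eq_mul,
      RCLike.inner_apply, conj_trivial]
    ring

/-- The octonions are right alternative. -/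
theorem mul_mul_star (x y : Octonion) : (y * x) * star x = (inner ℝ x x : ℝ) • y := by
  simp only [CD.inner_eq]
  refine ext_components (ext_components (ext_components ?_ ?_) (ext_components ?_ ?_))
    (ext_components (ext_components ?_ ?_) (ext_components ?_ ?_)) <;>
  · simp only [left_mul, right_mul, left_star, right_star, left_smul, right_smul, left_neg,
      right_neg, left_add, right_add, left_sub, right_sub, star_trivial, smul_eq_mul,
      RCLike.inner_apply, conj_trivial]
    ring

/-- The octonions are flexible. -/
theorem flexible (x y : Octonion) : (x * y) * x = x * (y * x) := by
  refine ext_components (ext_components (ext_components ?_ ?_) (ext_components ?_ ?_))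
    (ext_components (ext_components ?_ ?_) (ext_components ?_ ?_)) <;>
  · simp only [left_mul, right_mul, left_star, right_star, left_neg,
      right_neg, left_add, right_add, left_sub, right_sub, star_trivial]
    ring

theorem inner_mul_mul (x y : Octonion) :
    inner ℝ (x * y) (x * y) = (inner ℝ x x : ℝ) * inner ℝ y y := by
  rw [IsConj.inner_mul_left, star_mul_mul, inner_smul_right]

theorem eq_zero_or_eq_zero {x y : Octonion} (h : x * y = 0) : x = 0 ∨ y = 0 := by
  have h1 := inner_mul_mul x y
  rw [h, inner_zero_left] at h1
  rcases mul_eq_zero.1 h1.symm with h2 | h2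
  · exact Or.inl (inner_self_eq_zero.1 h2)
  · exact Or.inr (inner_self_eq_zero.1 h2)

theorem imag_mul_mul {x : Octonion} (hx : star x = -x) (y : Octonion) :
    x * (x * y) = -((inner ℝ x x : ℝ) • y) := by
  rw [← star_mul_mul, hx, neg_mul', neg_neg]

theorem mul_mul_imag {x : Octonion} (hx : star x = -x) (y : Octonion) :
    (y * x) * x = -((inner ℝ x x : ℝ) • y) := by
  rw [← mul_mul_star, hx, mul_neg', neg_neg]

theorem star_add_imag {x y : Octonion} (hx : star x = -x) (hy : star y = -y) :
    star (x + y) = -(x + y) := by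
  rw [IsBilin.star_add, hx, hy, neg_add]

/-- Linearized left alternativity. -/
theorem mul_mul_swap_left {x y : Octonion} (hx : star x = -x) (hy : star y = -y)
    (hxy : inner ℝ x y = (0 : ℝ)) (z : Octonion) : x * (y * z) = -(y * (x * z)) := by
  have h := imag_mul_mul (star_add_imag hx hy) z
  simp only [IsBilin.left_distrib, IsBilin.right_distrib, imag_mul_mul hx, imag_mul_mul hy,
    inner_add_left, inner_add_right, hxy, real_inner_comm x y] at h
  linear_combination (norm := module) h

theorem star_mul_imag {x y : Octonion} (hx : star x = -x) (hy : star y = -y)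
    (hxy : inner ℝ x y = (0 : ℝ)) : star (x * y) = -(x * y) := by
  rw [IsConj.star_mul, hx, hy, neg_mul', mul_neg', neg_neg, anticomm hx hy hxy, neg_neg]

/-- A basic triple of octonions antiassociates. -/
theorem antiassoc {x y z : Octonion} (hx : star x = -x) (hy : star y = -y) (hz : star z = -z)
    (hxy : inner ℝ x y = (0 : ℝ)) (hxz : inner ℝ x z = (0 : ℝ)) (hyz : inner ℝ y z = (0 : ℝ))
    (h : inner ℝ (x * y) z = (0 : ℝ)) : (x * y) * z = -(x * (y * z)) := by
  rw [anticomm (star_mul_imag hx hy hxy) hz h,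
    mul_mul_swap_left hz hx (by rw [real_inner_comm, hxz]), anticomm hy hz hyz, mul_neg']

/-- If the triple `x, m, y` antiassociates, where `x` and `y` are imaginary, then it is basic. -/
theorem basic_of_antiassoc {x y m : Octonion} (hx : star x = -x) (hy : star y = -y)
    (hx0 : x ≠ 0) (hy0 : y ≠ 0) (hm0 : m ≠ 0) (h : (x * m) * y = -(x * (m * y))) :
    star m = -m ∧ inner ℝ x m = (0 : ℝ) ∧ inner ℝ y m = (0 : ℝ) ∧ inner ℝ x y = (0 : ℝ) ∧
      inner ℝ (x * y) m = (0 : ℝ) := by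
  have hxx : (inner ℝ x x : ℝ) ≠ 0 := fun h => hx0 (inner_self_eq_zero.1 h)
  have hyy : (inner ℝ y y : ℝ) ≠ 0 := fun h => hy0 (inner_self_eq_zero.1 h)
  have hmm : (inner ℝ m m : ℝ) ≠ 0 := fun h => hm0 (inner_self_eq_zero.1 h)
  have key (v : Octonion) : inner ℝ ((x * m) * y) v = -(inner ℝ (x * (m * y)) v : ℝ) := by
    rw [h, inner_neg_left]
  -- The associator of `x, m, y` is orthogonal to `1`, `x`, `y`, `m` and `x y`.
  have hm : inner ℝ m (x * y) = (0 : ℝ) := by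
    have := key 1
    rw [inner_mul_imag hy, IsConj.one_mul, inner_imag_mul hx, inner_imag_mul hx, IsConj.mul_one,
      inner_mul_imag hy] at this
    linarith
  have hmy : inner ℝ m y = (0 : ℝ) := by
    have := key x
    rw [inner_mul_imag hy, IsConj.inner_mul_left, star_mul_mul, inner_smul_right,
      IsConj.inner_mul_left x (m * y), IsConj.star_mul_self, inner_smul_right,
      inner_mul_imag hy, IsConj.one_mul] at this
    have h2 : (inner ℝ x x : ℝ) * inner ℝ m y = 0 := by linarith
    exact (mul_eq_zero.1 h2).resolve_left hxx
  have hmx : inner ℝ m x = (0 : ℝ) := by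
    have := key y
    rw [IsConj.inner_mul_right (x * m) y, IsConj.mul_star, inner_smul_right,
      inner_imag_mul hx, IsConj.mul_one, inner_imag_mul hx, IsConj.inner_mul_right m y,
      mul_mul_star, inner_smul_right] at this
    have h2 : (inner ℝ y y : ℝ) * inner ℝ m x = 0 := by linarith
    exact (mul_eq_zero.1 h2).resolve_left hyy
  have hm1 : inner ℝ m 1 = (0 : ℝ) := by
    have := key (x * y)
    rw [IsConj.inner_mul_right (x * m) y, mul_mul_star, inner_smul_right, IsConj.inner_mul_left x m,
      IsConj.star_mul_self, inner_smul_right, IsConj.inner_mul_left x (m * y), star_mul_mul,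
      inner_smul_right, IsConj.inner_mul_right m y, IsConj.mul_star, inner_smul_right] at this
    have h2 : (inner ℝ y y : ℝ) * (inner ℝ x x * inner ℝ m 1) = 0 := by linarith
    exact (mul_eq_zero.1 ((mul_eq_zero.1 h2).resolve_left hyy)).resolve_left hxx
  have hms : star m = -m := star_eq_neg_iff.2 hm1
  refine ⟨hms, by rwa [real_inner_comm], by rwa [real_inner_comm], ?_, by rwa [real_inner_comm]⟩
  have := key m
  rw [inner_mul_imag hy, inner_imag_mul hx (m * y), real_inner_comm (x * m),
    anticomm hx hms (by rwa [real_inner_comm]), inner_neg_left, real_inner_comm,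
    IsConj.inner_mul_left m, star_mul_mul, inner_smul_right, real_inner_comm] at this
  have h2 : (inner ℝ m m : ℝ) * inner ℝ y x = 0 := by linarith
  rw [real_inner_comm]
  exact (mul_eq_zero.1 h2).resolve_left hmm

end Octonion

/-! ### Zero divisors of the sedenions -/

open CD Octonion

/-- The annihilator of an imaginary zero divisor `X = A + B e`: the octonions `A` and `B` are
imaginary, orthogonal and of the same norm, and `X` annihilates `c + d e` only if `d` is orthogonal
to the quaternion algebra generated by `A` and `B`, and `c = |A|⁻² (A B) d`. -/
theorem zero_divisor {X v : Sedenion} (hX : star X = -X) (hX0 : X ≠ 0) (hv0 : v ≠ 0)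
    (h : X * v = 0) :
    star X.left = -X.left ∧ star X.right = -X.right ∧ X.left ≠ 0 ∧ X.right ≠ 0 ∧
      inner ℝ X.right X.right = (inner ℝ X.left X.left : ℝ) ∧
      inner ℝ X.left X.right = (0 : ℝ) ∧ v.right ≠ 0 ∧ star v.right = -v.right ∧
      inner ℝ X.left v.right = (0 : ℝ) ∧ inner ℝ X.right v.right = (0 : ℝ) ∧
      inner ℝ (X.left * X.right) v.right = (0 : ℝ) ∧
      (inner ℝ X.left X.left : ℝ) • v.left = (X.left * X.right) * v.right := by
  have hA : star X.left = -X.left := congrArg CD.left hX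
  have h1 : X.left * v.left = star v.right * X.right := sub_eq_zero.1 (congrArg CD.left h)
  have h2 : v.right * X.left = -(X.right * star v.left) :=
    eq_neg_of_add_eq_zero_left (congrArg CD.right h)
  generalize hAe : X.left = A at *
  generalize hBe : X.right = B at *
  generalize hce : v.left = c at *
  generalize hde : v.right = d at *
  have hAB0 : ¬(A = 0 ∧ B = 0) := fun ⟨hA0, hB0⟩ =>
    hX0 (ext_components (by rw [hAe, hA0]; rfl) (by rw [hBe, hB0]; rfl))
  have hcd0 : ¬(c = 0 ∧ d = 0) := fun ⟨hc0, hd0⟩ =>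
    hv0 (ext_components (by rw [hce, hc0]; rfl) (by rw [hde, hd0]; rfl))
  have pos {x y : Octonion} (hxy : ¬(x = 0 ∧ y = 0)) : 0 < (inner ℝ x x + inner ℝ y y : ℝ) := by
    rcases not_and_or.1 hxy with h | h
    · have := real_inner_self_nonneg (x := y)
      have := real_inner_self_pos.2 h
      linarith
    · have := real_inner_self_nonneg (x := x)
      have := real_inner_self_pos.2 h
      linarith
  have hpos := pos hcd0
  -- Comparing `⟨A c, conj d⟩` with `⟨d A, conj c⟩` shows that `B` is imaginary.
  have hB1 : inner ℝ B 1 = (0 : ℝ) := by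
    have e1 : inner ℝ (A * c) (star d) = (inner ℝ d d : ℝ) * inner ℝ B 1 := by
      rw [h1, IsConj.inner_mul_left, IsConj.star_star, IsConj.mul_star, inner_smul_right]
    have e2 : inner ℝ (d * A) (star c) = -((inner ℝ c c : ℝ) * inner ℝ B 1) := by
      rw [h2, inner_neg_left, IsConj.inner_mul_right, IsConj.star_star, IsConj.star_mul_self,
        inner_smul_right]
    have e3 : inner ℝ (d * A) (star c) = (inner ℝ (A * c) (star d) : ℝ) := by
      rw [← IsConj.inner_star, IsConj.star_mul, IsConj.star_star, hA, neg_mul', inner_neg_left,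
        inner_imag_mul hA, neg_neg, real_inner_comm]
    have : (inner ℝ c c + inner ℝ d d : ℝ) * inner ℝ B 1 = 0 := by linarith
    exact (mul_eq_zero.1 this).resolve_left hpos.ne'
  have hB : star B = -B := star_eq_neg_iff.2 hB1
  have n1 : (inner ℝ A A : ℝ) * inner ℝ c c = inner ℝ d d * inner ℝ B B := by
    rw [← inner_mul_mul, h1, inner_mul_mul, IsConj.inner_star]
  have n2 : (inner ℝ d d : ℝ) * inner ℝ A A = inner ℝ B B * inner ℝ c c := by
    rw [← inner_mul_mul, h2, inner_neg_neg, inner_mul_mul, IsConj.inner_star]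
  have hN : inner ℝ B B = (inner ℝ A A : ℝ) := by
    have : (inner ℝ c c + inner ℝ d d : ℝ) * (inner ℝ B B - inner ℝ A A) = 0 := by linarith
    linarith [(mul_eq_zero.1 this).resolve_left hpos.ne']
  have hAp : 0 < (inner ℝ A A : ℝ) := by
    have := pos hAB0
    linarith
  have hA0 : A ≠ 0 := fun h => by rw [h, inner_zero_left] at hAp; exact hAp.false
  have hB0 : B ≠ 0 := fun h => by
    rw [← hN, h, inner_zero_left] at hAp; exact hAp.false
  have hd0 : d ≠ 0 := fun h => by
    rw [h, inner_zero_left, zero_mul] at n1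
    have := (mul_eq_zero.1 n1).resolve_left hAp.ne'
    exact hcd0 ⟨inner_self_eq_zero.1 this, h⟩
  have hm0 : star d ≠ 0 := fun h => hd0 (by rw [← IsConj.star_star d, h, star_zero'])
  have h3 : A * star d = -(c * B) := by
    have := congrArg star h2
    rw [IsConj.star_mul, hA, neg_mul', star_neg', IsConj.star_mul, hB, IsConj.star_star,
      mul_neg', neg_neg] at this
    rw [← this, neg_neg]
  obtain ⟨hm, hAm, hBm, hABi, hABm⟩ := basic_of_antiassoc hA hB hA0 hB0 hm0 (by
    rw [← h1, imag_mul_mul hA, h3, neg_mul', mul_mul_imag hB, hN])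
  have hd : star d = -d := by
    rw [IsConj.star_star] at hm
    exact (neg_eq_iff_eq_neg.2 hm).symm
  rw [hd, inner_neg_right, neg_eq_zero] at hAm hBm hABm
  refine ⟨hA, hB, hA0, hB0, hN, hABi, hd0, hd, hAm, hBm, hABm, ?_⟩
  have h4 : B * d = A * c := by rw [h1, hd, anticomm hB hd hBm, neg_mul']
  rw [antiassoc hA hB hd hABi hAm hBm hABm, h4, imag_mul_mul hA, neg_neg]

/-- The converse of `zero_divisor`. -/
theorem mul_eq_zero_of_orthogonal {X v : Sedenion} (hA : star X.left = -X.left)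
    (hB : star X.right = -X.right) (hA0 : X.left ≠ 0)
    (hN : inner ℝ X.right X.right = (inner ℝ X.left X.left : ℝ))
    (hAB : inner ℝ X.left X.right = (0 : ℝ)) (hd : star v.right = -v.right)
    (hAd : inner ℝ X.left v.right = (0 : ℝ)) (hBd : inner ℝ X.right v.right = (0 : ℝ))
    (hABd : inner ℝ (X.left * X.right) v.right = (0 : ℝ))
    (hc : (inner ℝ X.left X.left : ℝ) • v.left = (X.left * X.right) * v.right) :
    X * v = 0 := by
  have hn : (inner ℝ X.left X.left : ℝ) ≠ 0 := fun h => hA0 (inner_self_eq_zero.1 h)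
  have hAsm := antiassoc hA hB hd hAB hAd hBd hABd
  refine ext_components (smul_right_injective _ hn ?_) (smul_right_injective _ hn ?_)
  · simp only [left_mul, left_zero, smul_zero, smul_sub, hd]
    rw [← IsBilin.mul_smul, hc, hAsm, mul_neg', imag_mul_mul hA, anticomm hB hd hBd, neg_mul']
    module
  · simp only [right_mul, right_zero, smul_zero, smul_add]
    rw [← IsBilin.mul_smul _ X.right, ← IsBilin.star_smul, hc,
      star_mul_imag (star_mul_imag hA hB hAB) hd hABd, hAsm, mul_mul_swap_left hA hB hAB,
      neg_neg, mul_neg', imag_mul_mul hB, hN, anticomm hA hd hAd]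
    module

/-! ### Slice units -/

theorem L_apply (s x : Sedenion) : L s x = s * x := rfl

theorem mem_sliceUnits {s : Sedenion} : s ∈ sliceUnits ↔ ∀ x, s * (s * x) = -x := by
  constructor
  · intro h x
    exact congrArg (fun f => f x) (h : L s * L s = -1)
  · intro h
    exact LinearMap.ext h

theorem sliceUnits_star {s : Sedenion} (hs : s ∈ sliceUnits) : star s = -s := by
  have h1 : s * s = -1 := by
    have := mem_sliceUnits.1 hs 1
    rwa [IsConj.mul_one] at this
  have h2 := IsConj.mul_star s
  rw [IsConj.star_eq, mul_sub', IsBilin.mul_smul, IsConj.mul_one, h1] at h2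
  rw [star_eq_neg_iff]
  by_contra h0
  -- Otherwise `s` is real, hence has a positive square.
  have h3 : s = ((inner ℝ s s - 1) / (2 * inner ℝ s 1) : ℝ) • (1 : Sedenion) := by
    have h4 : (2 * inner ℝ s 1 : ℝ) ≠ 0 := by simpa using h0
    refine smul_right_injective _ h4 ?_
    simp only [smul_smul]
    rw [mul_div_cancel₀ _ h4]
    linear_combination (norm := module) h2
  set r : ℝ := (inner ℝ s s - 1) / (2 * inner ℝ s 1) with hr
  have h5 := congrArg (fun x => inner ℝ x (1 : Sedenion)) h1
  rw [h3, IsBilin.smul_mul, IsConj.one_mul, inner_smul_left, inner_smul_left, inner_neg_left,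
    IsConj.inner_one_one] at h5
  simp only [conj_trivial, mul_one] at h5
  nlinarith [mul_self_nonneg r]

theorem neg_mem_sliceUnits {s : Sedenion} (hs : s ∈ sliceUnits) : -s ∈ sliceUnits := by
  rw [mem_sliceUnits] at *
  intro x
  rw [neg_mul', neg_mul', mul_neg', neg_neg, hs]

theorem inner_unit_mul {s : Sedenion} (hs : s ∈ sliceUnits) (x y : Sedenion) :
    inner ℝ (s * x) y = -(inner ℝ x (s * y) : ℝ) :=
  inner_imag_mul (sliceUnits_star hs) x y

theorem norm_unit_mul {s : Sedenion} (hs : s ∈ sliceUnits) (x : Sedenion) : ‖s * x‖ = ‖x‖ := by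
  have : (inner ℝ (s * x) (s * x) : ℝ) = inner ℝ x x := by
    rw [inner_unit_mul hs, mem_sliceUnits.1 hs, inner_neg_right, neg_neg]
  rw [real_inner_self_eq_norm_sq, real_inner_self_eq_norm_sq] at this
  exact (sq_eq_sq₀ (norm_nonneg _) (norm_nonneg _)).1 this

theorem norm_one_sedenion : ‖(1 : Sedenion)‖ = 1 := by
  have := IsConj.inner_one_one (A := Sedenion)
  rw [real_inner_self_eq_norm_sq] at this
  exact (pow_eq_one_iff_of_nonneg (norm_nonneg _) two_ne_zero).1 this

theorem norm_unit {s : Sedenion} (hs : s ∈ sliceUnits) : ‖s‖ = 1 := by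
  rw [← IsConj.mul_one s, norm_unit_mul hs, norm_one_sedenion]

theorem inner_unit_one {s : Sedenion} (hs : s ∈ sliceUnits) : inner ℝ s 1 = (0 : ℝ) :=
  star_eq_neg_iff.1 (sliceUnits_star hs)

noncomputable instance {A : Type} [NormedAddCommGroup A] [InnerProductSpace ℝ A]
    [FiniteDimensional ℝ A] : FiniteDimensional ℝ (CD A) :=
  inferInstanceAs (FiniteDimensional ℝ (WithLp 2 (A × A)))

theorem finrank_CD {A : Type} [NormedAddCommGroup A] [InnerProductSpace ℝ A]
    [FiniteDimensional ℝ A] : Module.finrank ℝ (CD A) = 2 * Module.finrank ℝ A := by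
  change Module.finrank ℝ (WithLp 2 (A × A)) = _
  rw [(WithLp.linearEquiv 2 ℝ (A × A)).finrank_eq, Module.finrank_prod, two_mul]

/-- Imaginary octonions `x`, `y` which associate with every octonion are linearly dependent. -/
theorem Octonion.dependent_of_assoc {x y : Octonion} (hx : star x = -x) (hy : star y = -y)
    (h : ∀ m, (x * m) * y = x * (m * y)) :
    ∃ u : Octonion, star u = -u ∧ ∃ r s : ℝ, x = r • u ∧ y = s • u := by
  by_cases hx0 : x = 0
  · exact ⟨y, hy, 0, 1, by simp [hx0], by simp⟩
  have hxx : (inner ℝ x x : ℝ) ≠ 0 := fun h => hx0 (inner_self_eq_zero.1 h)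
  refine ⟨x, hx, 1, inner ℝ x y / inner ℝ x x, by simp, ?_⟩
  set y' : Octonion := y - (inner ℝ x y / inner ℝ x x : ℝ) • x with hy'
  suffices y' = 0 from sub_eq_zero.1 this
  have hyi : star y' = -y' := by
    rw [hy', star_sub', IsBilin.star_smul, hx, hy]
    module
  have hxy : inner ℝ x y' = (0 : ℝ) := by
    rw [hy', inner_sub_right, inner_smul_right, div_mul_cancel₀ _ hxx, sub_self]
  have h' (m : Octonion) : (x * m) * y' = x * (m * y') := by
    rw [hy', mul_sub', mul_sub', mul_sub', h, IsBilin.mul_smul, IsBilin.mul_smul,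
      IsBilin.mul_smul]
    rw [flexible]
  -- An element orthogonal to `1`, `x`, `y'` and `x y'` exists for reasons of dimension.
  let f : Octonion →ₗ[ℝ] (Fin 4 → ℝ) := LinearMap.pi
    ![(innerSL ℝ (1 : Octonion)).toLinearMap, (innerSL ℝ x).toLinearMap,
      (innerSL ℝ y').toLinearMap, (innerSL ℝ (x * y')).toLinearMap]
  obtain ⟨m, hm, hm0⟩ : ∃ m ∈ LinearMap.ker f, m ≠ 0 := by
    refine (Submodule.ne_bot_iff _).1 (LinearMap.ker_ne_bot_of_finrank_lt ?_)
    rw [finrank_CD, finrank_CD, finrank_CD]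
    simp
  have hfm (i : Fin 4) : f m i = 0 := by rw [LinearMap.mem_ker.1 hm]; rfl
  have hm1 : inner ℝ m 1 = (0 : ℝ) := by rw [real_inner_comm]; exact hfm 0
  have hxm : inner ℝ x m = (0 : ℝ) := hfm 1
  have hym : inner ℝ y' m = (0 : ℝ) := hfm 2
  have hxym : inner ℝ (x * y') m = (0 : ℝ) := hfm 3
  have hmi : star m = -m := star_eq_neg_iff.2 hm1
  have h1 : inner ℝ (x * m) y' = (0 : ℝ) := by
    rw [inner_imag_mul hx, real_inner_comm, hxym, neg_zero]
  have h2 := antiassoc hx hmi hyi hxm hxy (by rwa [real_inner_comm]) h1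
  have h3 : (x * m) * y' = 0 := by
    rw [← h' m] at h2
    have h5 : (2 : ℝ) • ((x * m) * y') = 0 := by linear_combination (norm := module) h2
    exact (smul_eq_zero.1 h5).resolve_left two_ne_zero
  rcases eq_zero_or_eq_zero h3 with h4 | h4
  · rcases eq_zero_or_eq_zero h4 with h5 | h5
    · exact absurd h5 hx0
    · exact absurd h5 hm0
  · exact h4

/-- The components of a slice unit lie, up to a multiple of `e`, on one imaginary line. -/
theorem sliceUnits_form {s : Sedenion} (hs : s ∈ sliceUnits) :
    ∃ u : Octonion, star u = -u ∧ ∃ x t z : ℝ, s.left = x • u ∧ s.right = t • 1 + z • u := by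
  have ha : star s.left = -s.left := congrArg CD.left (sliceUnits_star hs)
  set t : ℝ := inner ℝ s.right 1 with ht
  have hb : star (s.right - t • (1 : Octonion)) = -(s.right - t • (1 : Octonion)) := by
    rw [star_sub', IsBilin.star_smul, star_one', IsConj.star_eq]
    module
  obtain ⟨u, hu, x, z, hx, hz⟩ := dependent_of_assoc ha hb fun m => by
    have h := congrArg CD.left (mem_sliceUnits.1 hs (mk 0 (star m)))
    simp only [left_mul, right_mul, left_mk, right_mk, left_neg, star_zero', mul_zero',
      add_zero, zero_sub, neg_zero, IsConj.star_mul, IsConj.star_star, ha, neg_mul',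
      mul_neg'] at h
    rw [mul_sub', mul_sub', mul_sub', IsBilin.mul_smul, IsBilin.mul_smul, IsBilin.mul_smul,
      IsConj.mul_one, IsConj.mul_one]
    linear_combination (norm := module) h
  exact ⟨u, hu, x, t, z, hx, by rw [← hz]; module⟩

/-- If orthogonal imaginary octonions `A`, `B` of the same norm span a plane containing `u ≠ 0`,
then orthogonality to the plane only depends on `u` and `g = |A|⁻² A B`. -/
theorem Octonion.orthogonal_plane_iff {A B u g d : Octonion} (hA : star A = -A) (hB : star B = -B)
    (hA0 : A ≠ 0) (hN : inner ℝ B B = (inner ℝ A A : ℝ)) (hAB : inner ℝ A B = (0 : ℝ))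
    (hg : (inner ℝ A A : ℝ) • g = A * B) {r s : ℝ} (hu : u = r • A + s • B) (hu0 : u ≠ 0) :
    (inner ℝ A d = (0 : ℝ) ∧ inner ℝ B d = (0 : ℝ)) ↔
      (inner ℝ u d = (0 : ℝ) ∧ inner ℝ (g * u) d = (0 : ℝ)) := by
  have hn : (inner ℝ A A : ℝ) ≠ 0 := fun h => hA0 (inner_self_eq_zero.1 h)
  have hgu : g * u = r • B - s • A := by
    refine smul_right_injective _ hn ?_
    simp only
    rw [← IsBilin.smul_mul, hg, hu, IsBilin.left_distrib, IsBilin.mul_smul, IsBilin.mul_smul,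
      mul_mul_imag hB, hN, anticomm hA hB hAB, neg_mul', mul_mul_imag hA]
    module
  have hrs : r * r + s * s ≠ 0 := fun h => by
    have hr : r = 0 := by nlinarith [mul_self_nonneg r, mul_self_nonneg s]
    have hs : s = 0 := by nlinarith [mul_self_nonneg r, mul_self_nonneg s]
    exact hu0 (by rw [hu, hr, hs]; simp)
  rw [hgu, hu]
  simp only [inner_add_left, inner_sub_left, inner_smul_left, conj_trivial]
  constructor
  · rintro ⟨h1, h2⟩
    rw [h1, h2]
    simp
  · rintro ⟨h1, h2⟩
    constructor
    · refine (mul_eq_zero.1 ?_).resolve_left hrs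
      linear_combination r * h1 - s * h2
    · refine (mul_eq_zero.1 ?_).resolve_left hrs
      linear_combination s * h1 + r * h2

/-- If `A = x u - x' u'` and `B = z u - z' u'` are orthogonal and nonzero, then `u` lies in the
plane of `A` and `B`. -/
theorem mem_plane {A B u u' : Octonion} {x z x' z' : ℝ} (hA : A = x • u - x' • u')
    (hB : B = z • u - z' • u') (hA0 : A ≠ 0) (hB0 : B ≠ 0) (hAB : inner ℝ A B = (0 : ℝ)) :
    u ≠ 0 ∧ ∃ r s : ℝ, u = r • A + s • B := by
  have indep {r s : ℝ} (h : r • A + s • B = 0) : r = 0 ∧ s = 0 := by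
    have h1 := congrArg (fun y => inner ℝ A y) h
    have h2 := congrArg (fun y => inner ℝ B y) h
    simp only [inner_add_right, inner_smul_right, hAB, real_inner_comm A B, inner_zero_right,
      mul_zero, zero_add, add_zero] at h1 h2
    exact ⟨(mul_eq_zero.1 h1).resolve_right fun h => hA0 (inner_self_eq_zero.1 h),
      (mul_eq_zero.1 h2).resolve_right fun h => hB0 (inner_self_eq_zero.1 h)⟩
  have e1 : z' • A + (-x') • B = (z' * x - x' * z) • u := by rw [hA, hB]; module
  have e2 (h : x' = 0 ∧ z' = 0) : z • A + (-x) • B = 0 := by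
    rw [hA, hB, h.1, h.2]; module
  have hne : z' * x - x' * z ≠ 0 ∧ u ≠ 0 := by
    rw [← smul_ne_zero_iff, ← e1]
    intro h
    obtain ⟨h1, h2⟩ := indep h
    have h3 : x' = 0 := neg_eq_zero.1 h2
    obtain ⟨h4, h5⟩ := indep (e2 ⟨h3, h1⟩)
    refine hA0 ?_
    rw [hA, h3, neg_eq_zero.1 h5]
    simp
  refine ⟨hne.2, z' / (z' * x - x' * z), -x' / (z' * x - x' * z), ?_⟩
  refine smul_right_injective _ hne.1 ?_
  simp only [smul_add, smul_smul]
  rw [mul_div_cancel₀ _ hne.1, mul_div_cancel₀ _ hne.1, e1]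

/-- The key fact on slice units: if `J` and `K` differ from `I` and agree with `I` at a common
nonzero sedenion, then they agree with `I` at the same sedenions. -/
theorem mul_eq_mul_of_common {I J K v w : Sedenion} (hI : I ∈ sliceUnits) (hJ : J ∈ sliceUnits)
    (hK : K ∈ sliceUnits) (hIJ : I ≠ J) (hIK : I ≠ K) (hv0 : v ≠ 0) (hvJ : (I - J) * v = 0)
    (hvK : (I - K) * v = 0) (hw : (I - J) * w = 0) : (I - K) * w = 0 := by
  by_cases hw0 : w = 0
  · rw [hw0, mul_zero']
  have im {J : Sedenion} (hJ : J ∈ sliceUnits) : star (I - J) = -(I - J) := by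
    rw [star_sub', sliceUnits_star hI, sliceUnits_star hJ]
    module
  obtain ⟨u, hu, x, t, z, hx, hz⟩ := sliceUnits_form hI
  have plane {J : Sedenion} (hJ : J ∈ sliceUnits) (hIJ : I ≠ J) (h : (I - J) * v = 0) :
      u ≠ 0 ∧ ∃ r s : ℝ, u = r • (I - J).left + s • (I - J).right := by
    obtain ⟨-, hB, hA0, hB0, -, hAB, -⟩ := zero_divisor (im hJ) (sub_ne_zero.2 hIJ) hv0 h
    obtain ⟨u', hu', x', t', z', hx', hz'⟩ := sliceUnits_form hJ
    have ht : t - t' = 0 := by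
      have := star_eq_neg_iff.1 hB
      rw [right_sub, hz, hz'] at this
      simpa only [inner_sub_left, inner_add_left, inner_smul_left, IsConj.inner_one_one,
        star_eq_neg_iff.1 hu, star_eq_neg_iff.1 hu', conj_trivial, mul_one, mul_zero,
        add_zero] using this
    refine mem_plane (u' := u') (x := x) (x' := x') (z := z) (z' := z') ?_ ?_ hA0 hB0 hAB
    · rw [left_sub, hx, hx']
    · rw [right_sub, hz, hz', sub_eq_zero.1 ht]
      module
  obtain ⟨hu0, r, s, hrs⟩ := plane hJ hIJ hvJ
  obtain ⟨-, r', s', hrs'⟩ := plane hK hIK hvK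
  obtain ⟨hA, hB, hA0, hB0, hN, hAB, hd0, hd, hAd, hBd, hABd, hc⟩ :=
    zero_divisor (im hJ) (sub_ne_zero.2 hIJ) hv0 hvJ
  obtain ⟨hA', hB', hA0', hB0', hN', hAB', -, -, -, -, -, hc'⟩ :=
    zero_divisor (im hK) (sub_ne_zero.2 hIK) hv0 hvK
  obtain ⟨-, -, -, -, -, -, -, hwd, hAw, hBw, hABw, hwc⟩ :=
    zero_divisor (im hJ) (sub_ne_zero.2 hIJ) hw0 hw
  generalize (I - J).left = A at *
  generalize (I - J).right = B at *
  have hn : (inner ℝ A A : ℝ) ≠ 0 := fun h => hA0 (inner_self_eq_zero.1 h)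
  have hn' : (inner ℝ (I - K).left (I - K).left : ℝ) ≠ 0 :=
    fun h => hA0' (inner_self_eq_zero.1 h)
  obtain ⟨g, hg⟩ : ∃ g : Octonion, (inner ℝ A A : ℝ) • g = A * B :=
    ⟨(inner ℝ A A : ℝ)⁻¹ • (A * B), smul_inv_smul₀ hn _⟩
  obtain ⟨g', hg'⟩ : ∃ g' : Octonion,
      (inner ℝ (I - K).left (I - K).left : ℝ) • g' = (I - K).left * (I - K).right :=
    ⟨_, smul_inv_smul₀ hn' _⟩
  have quot {g : Octonion} {n : ℝ} {c d m : Octonion} (hn : n ≠ 0) (hg : n • g = m)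
      (hc : n • c = m * d) : c = g * d := by
    rw [← hg, IsBilin.smul_mul] at hc
    exact smul_right_injective _ hn hc
  -- The quotient of the components of `v` determines `|A|⁻² A B`.
  have hgg : g = g' := by
    have h0 : (g - g') * v.right = 0 := by
      rw [sub_mul', ← quot hn hg hc, ← quot hn' hg' hc', sub_self]
    exact sub_eq_zero.1 ((eq_zero_or_eq_zero h0).resolve_right hd0)
  have hg'w : inner ℝ g w.right = (0 : ℝ) := by
    rw [← hg, inner_smul_left] at hABw
    exact (mul_eq_zero.1 hABw).resolve_left hn
  have hplane := (orthogonal_plane_iff hA' hB' hA0' hN' hAB' hg' hrs' hu0).2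
    (hgg ▸ (orthogonal_plane_iff hA hB hA0 hN hAB hg hrs hu0).1 ⟨hAw, hBw⟩)
  refine mul_eq_zero_of_orthogonal hA' hB' hA0' hN' hAB' hwd hplane.1 hplane.2 ?_ ?_
  · rw [← hg', ← hgg, inner_smul_left, hg'w, mul_zero]
  · rw [← hg', ← hgg, IsBilin.smul_mul, ← quot hn hg hwc]

/-! ### The root test -/

/-- The convergence radius `1 / limsup uₙ^{1/n}` of a sequence of nonnegative numbers. -/
noncomputable def rootRadius (u : ℕ → ℝ) : ℝ≥0∞ :=
  (limsup (fun n : ℕ => ENNReal.ofReal (u n ^ (1 / (n : ℝ)))) atTop)⁻¹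

theorem summable_of_lt_rootRadius {u : ℕ → ℝ} (hu : ∀ n, 0 ≤ u n) {t : ℝ} (ht : 0 ≤ t)
    (h : ENNReal.ofReal t < rootRadius u) : Summable fun n => t ^ n * u n := by
  obtain ⟨r, h1, h2⟩ := ENNReal.lt_iff_exists_nnreal_btwn.1 h
  have htr : t < r := by
    rw [ENNReal.ofReal_lt_coe_iff ht] at h1
    exact h1
  have hr : (0 : ℝ) < r := ht.trans_lt htr
  have h3 := ENNReal.lt_inv_iff_lt_inv.1 h2
  have h4 : ∀ᶠ n in atTop, ‖t ^ n * u n‖ ≤ (t / r) ^ n := by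
    filter_upwards [eventually_lt_of_limsup_lt h3, eventually_ge_atTop 1] with n hn h1n
    have hn0 : (n : ℝ) ≠ 0 := by positivity
    have h5 : u n ^ (1 / (n : ℝ)) < (r : ℝ)⁻¹ := by
      rw [← ENNReal.ofReal_coe_nnreal, ← ENNReal.ofReal_inv_of_pos hr] at hn
      exact (ENNReal.ofReal_lt_ofReal_iff (inv_pos.2 hr)).1 hn
    have h6 : u n ≤ ((r : ℝ)⁻¹) ^ n := by
      have := pow_le_pow_left₀ (Real.rpow_nonneg (hu n) _) h5.le n
      rwa [← Real.rpow_natCast, ← Real.rpow_mul (hu n), one_div, inv_mul_cancel₀ hn0,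
        Real.rpow_one] at this
    rw [Real.norm_of_nonneg (mul_nonneg (pow_nonneg ht n) (hu n)), div_eq_mul_inv, mul_pow]
    gcongr
  refine Summable.of_norm_bounded_eventually_nat ?_ h4
  exact summable_geometric_of_lt_one (by positivity) ((div_lt_one hr).2 htr)

theorem le_rootRadius_of_bounded {u : ℕ → ℝ} (hu : ∀ n, 0 ≤ u n) {t M : ℝ}
    (h : ∀ᶠ n in atTop, t ^ n * u n ≤ M) : ENNReal.ofReal t ≤ rootRadius u := by
  refine le_of_forall_lt fun s hs => ?_
  obtain ⟨r, h1, h2⟩ := ENNReal.lt_iff_exists_nnreal_btwn.1 hs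
  refine h1.trans_le ?_
  rcases eq_or_ne r 0 with rfl | hr0
  · simp
  have hr : (0 : ℝ) < r := by positivity
  have hrt : (r : ℝ) < t := by
    rw [ENNReal.coe_lt_ofReal] at h2
    exact h2
  have ht0 : 0 < t := hr.trans hrt
  have hlim : Tendsto (fun n : ℕ => (r / t) ^ n * M) atTop (𝓝 0) := by
    simpa using (tendsto_pow_atTop_nhds_zero_of_lt_one (by positivity)
      ((div_lt_one ht0).2 hrt)).mul_const M
  rw [rootRadius, ENNReal.le_inv_iff_le_inv]
  refine limsup_le_of_le (by isBoundedDefault) ?_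
  filter_upwards [h, hlim.eventually_le_const one_pos, eventually_ge_atTop 1] with n hn h3 h1n
  have hn0 : (n : ℝ) ≠ 0 := by positivity
  have h4 : u n ≤ ((r : ℝ)⁻¹) ^ n := by
    have e : (r / t) ^ n * (t ^ n * u n) = r ^ n * u n := by
      rw [div_pow]; field_simp
    have : (r : ℝ) ^ n * u n ≤ 1 := by
      rw [← e]
      exact (mul_le_mul_of_nonneg_left hn (by positivity)).trans h3
    rw [inv_pow, ← one_div, le_div_iff₀ (by positivity)]
    linarith
  have h5 : u n ^ (1 / (n : ℝ)) ≤ (r : ℝ)⁻¹ := by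
    have := Real.rpow_le_rpow (hu n) h4 (z := 1 / (n : ℝ)) (by positivity)
    rwa [← Real.rpow_natCast, ← Real.rpow_mul (by positivity), mul_one_div_cancel hn0,
      Real.rpow_one] at this
  rw [← ENNReal.ofReal_coe_nnreal, ← ENNReal.ofReal_inv_of_pos hr]
  exact ENNReal.ofReal_le_ofReal h5

/-- A sequence dominated by another one up to a constant has the larger radius. -/
theorem rootRadius_le_of_le_mul {u v : ℕ → ℝ} (hu : ∀ n, 0 ≤ u n) (hv : ∀ n, 0 ≤ v n) {C : ℝ}
    (h : ∀ n, u n ≤ C * v n) : rootRadius v ≤ rootRadius u := by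
  refine le_of_forall_lt fun s hs => ?_
  obtain ⟨r, h1, h2⟩ := ENNReal.lt_iff_exists_nnreal_btwn.1 hs
  refine h1.trans_le ?_
  rw [← ENNReal.ofReal_coe_nnreal] at h2 ⊢
  have h3 := (summable_of_lt_rootRadius hv r.2 h2).tendsto_atTop_zero.mul_const C
  rw [zero_mul] at h3
  refine le_rootRadius_of_bounded (M := 1) hu ?_
  filter_upwards [h3.eventually_le_const one_pos] with n hn
  refine le_trans ?_ hn
  have := mul_le_mul_of_nonneg_left (h n) (pow_nonneg r.2 n)
  calc _ ≤ _ := this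
    _ = _ := by ring

/-- The radius of a sum of two sequences is at least the smaller radius. -/
theorem min_rootRadius_le {u v w : ℕ → ℝ} (hu : ∀ n, 0 ≤ u n) (hv : ∀ n, 0 ≤ v n)
    (hw : ∀ n, 0 ≤ w n) {C : ℝ} (h : ∀ n, u n ≤ C * (v n + w n)) :
    min (rootRadius v) (rootRadius w) ≤ rootRadius u := by
  refine le_of_forall_lt fun s hs => ?_
  obtain ⟨r, h1, h2⟩ := ENNReal.lt_iff_exists_nnreal_btwn.1 hs
  refine h1.trans_le ?_
  rw [← ENNReal.ofReal_coe_nnreal] at h2 ⊢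
  rw [lt_min_iff] at h2
  have h3 := ((summable_of_lt_rootRadius hv r.2 h2.1).add
    (summable_of_lt_rootRadius hw r.2 h2.2)).tendsto_atTop_zero.mul_const C
  rw [zero_mul] at h3
  refine le_rootRadius_of_bounded (M := 1) hu ?_
  filter_upwards [h3.eventually_le_const one_pos] with n hn
  refine le_trans ?_ hn
  have := mul_le_mul_of_nonneg_left (h n) (pow_nonneg r.2 n)
  calc _ ≤ _ := this
    _ = _ := by ring

theorem rootRadius_zero : rootRadius (fun _ => 0) = ⊤ := by
  refine top_le_iff.1 (ENNReal.le_of_forall_nnreal_lt fun r _ => ?_)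
  rw [← ENNReal.ofReal_coe_nnreal]
  exact le_rootRadius_of_bounded (M := 0) (fun _ => le_rfl) (by simp)

/-! ### The sedenions on which two slice units agree -/

/-- The space of the sedenions on which `I` and `K` agree, the kernel of `I - K`. -/
noncomputable def agree (I K : Sedenion) : Submodule ℝ Sedenion := LinearMap.ker (L (I - K))

theorem mem_agree_iff {I K v : Sedenion} : v ∈ agree I K ↔ (I - K) * v = 0 := Iff.rfl

theorem mem_agree {I K v : Sedenion} : v ∈ agree I K ↔ I * v = K * v := by
  rw [mem_agree_iff, sub_mul', sub_eq_zero]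

theorem agree_self (I : Sedenion) : agree I I = ⊤ := by
  ext v; simp [mem_agree]

theorem agree_neg {I : Sedenion} (hI : I ∈ sliceUnits) : agree I (-I) = ⊥ := by
  refine (Submodule.eq_bot_iff _).2 fun v hv => ?_
  rw [mem_agree, neg_mul'] at hv
  have h : (2 : ℝ) • (I * v) = 0 := by linear_combination (norm := module) hv
  have h2 := (smul_eq_zero.1 h).resolve_left two_ne_zero
  rw [← norm_eq_zero, ← norm_unit_mul hI, h2, norm_zero]

theorem unit_mul_mem_agree {I K v : Sedenion} (hI : I ∈ sliceUnits) (hK : K ∈ sliceUnits)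
    (hv : v ∈ agree I K) : I * v ∈ agree I K := by
  rw [mem_agree] at *
  rw [mem_sliceUnits.1 hI, hv, mem_sliceUnits.1 hK]

theorem unit_mul_mem_agree_orthogonal {I K v : Sedenion} (hI : I ∈ sliceUnits)
    (hK : K ∈ sliceUnits) (hv : v ∈ (agree I K)ᗮ) : I * v ∈ (agree I K)ᗮ := by
  rw [Submodule.mem_orthogonal'] at *
  intro u hu
  rw [inner_unit_mul hI, hv _ (unit_mul_mem_agree hI hK hu), neg_zero]

/-- The spaces on which two slice units agree with `I` are equal or independent. -/
theorem agree_eq_or_disjoint {I J K : Sedenion} (hI : I ∈ sliceUnits) (hJ : J ∈ sliceUnits)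
    (hK : K ∈ sliceUnits) (hIJ : I ≠ J) (hIK : I ≠ K) :
    agree I J = agree I K ∨ Disjoint (agree I J) (agree I K) := by
  rw [or_iff_not_imp_right, disjoint_iff, ← Ne, Submodule.ne_bot_iff]
  rintro ⟨v, ⟨hvJ, hvK⟩, hv0⟩
  exact le_antisymm
    (fun w hw => mul_eq_mul_of_common hI hJ hK hIJ hIK hv0 hvJ hvK hw)
    (fun w hw => mul_eq_mul_of_common hI hK hJ hIK hIJ hv0 hvK hvJ hw)

/-- The component of `v` orthogonal to the space on which `I` and `K` agree. -/
noncomputable def perp (I K v : Sedenion) : Sedenion := v - (agree I K).starProjection v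

theorem perp_mem (I K v : Sedenion) : perp I K v ∈ (agree I K)ᗮ :=
  (agree I K).sub_starProjection_mem_orthogonal v

theorem sub_perp_mem (I K v : Sedenion) : v - perp I K v ∈ agree I K := by
  rw [perp, sub_sub_cancel]
  exact Submodule.starProjection_apply_mem _ _

theorem infDist_agree (I K v : Sedenion) :
    Metric.infDist v {c | (I - K) * c = 0} = ‖perp I K v‖ := by
  rw [perp, Submodule.starProjection_minimal, Metric.infDist_eq_iInf]
  simp only [dist_eq_norm]
  rfl

theorem norm_perp_le (I K v : Sedenion) : ‖perp I K v‖ ≤ ‖v‖ := by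
  rw [← infDist_agree, ← dist_zero_right]
  exact Metric.infDist_le_dist_of_mem (mul_zero' _)

theorem norm_perp_anti {I J K : Sedenion} (h : agree I J ≤ agree I K) (v : Sedenion) :
    ‖perp I K v‖ ≤ ‖perp I J v‖ := by
  rw [← infDist_agree, ← infDist_agree]
  exact Metric.infDist_le_infDist_of_subset h ⟨0, mul_zero' _⟩

theorem perp_self (I v : Sedenion) : perp I I v = 0 := by
  rw [perp, sub_eq_zero, eq_comm, Submodule.starProjection_eq_self_iff, agree_self]
  trivial

/-- The projection `perp I K`, as a linear map. -/
noncomputable def perpLM (I K : Sedenion) : Sedenion →ₗ[ℝ] Sedenion :=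
  LinearMap.id - (agree I K).starProjection.toLinearMap

/-- The distances to two subspaces which meet in `0` only bound the norm. -/
theorem norm_le_of_disjoint {I J K : Sedenion} (h : Disjoint (agree I J) (agree I K)) :
    ∃ C : ℝ, ∀ v, ‖v‖ ≤ C * (‖perp I J v‖ + ‖perp I K v‖) := by
  have hker : LinearMap.ker ((perpLM I J).prod (perpLM I K)) = ⊥ := by
    refine (Submodule.eq_bot_iff _).2 fun v hv => ?_
    have hv1 : perp I J v = 0 := congrArg Prod.fst (LinearMap.mem_ker.1 hv)
    have hv2 : perp I K v = 0 := congrArg Prod.snd (LinearMap.mem_ker.1 hv)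
    have h1 : v - 0 ∈ agree I J := by
      have := sub_perp_mem I J v
      rwa [hv1] at this
    have h2 : v - 0 ∈ agree I K := by
      have := sub_perp_mem I K v
      rwa [hv2] at this
    rw [sub_zero] at h1 h2
    exact (Submodule.disjoint_def.1 h) v h1 h2
  obtain ⟨C, -, hC⟩ := LinearMap.exists_antilipschitzWith _ hker
  refine ⟨C, fun v => ?_⟩
  have := hC.le_mul_dist v 0
  rw [map_zero, dist_zero_right, dist_zero_right] at this
  refine this.trans (mul_le_mul_of_nonneg_left ?_ C.2)
  exact max_le (le_add_of_nonneg_right (norm_nonneg _)) (le_add_of_nonneg_left (norm_nonneg _))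

/-- The radius of the distances of the coefficients to the space on which `I` and `K` agree. -/
noncomputable def perpRadius (I : Sedenion) (a : ℕ → Sedenion) (K : Sedenion) : ℝ≥0∞ :=
  rootRadius fun n => ‖perp I K (a n)‖

theorem perpRadius_self (I : Sedenion) (a : ℕ → Sedenion) : perpRadius I a I = ⊤ := by
  simp only [perpRadius, perp_self, norm_zero, rootRadius_zero]

theorem radius_le_perpRadius (I : Sedenion) (a : ℕ → Sedenion) (K : Sedenion) :
    radius a ≤ perpRadius I a K :=
  rootRadius_le_of_le_mul (C := 1) (fun _ => norm_nonneg _) (fun _ => norm_nonneg _)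
    fun n => by rw [one_mul]; exact norm_perp_le _ _ _

theorem perpRadius_mono {I : Sedenion} (a : ℕ → Sedenion) {J K : Sedenion}
    (h : agree I J ≤ agree I K) : perpRadius I a J ≤ perpRadius I a K :=
  rootRadius_le_of_le_mul (C := 1) (fun _ => norm_nonneg _) (fun _ => norm_nonneg _)
    fun n => by rw [one_mul]; exact norm_perp_anti h _

/-- Of two slice units which agree with `I` on independent spaces, at most one has a radius larger
than that of the series. -/
theorem min_perpRadius_le {I J K : Sedenion} (a : ℕ → Sedenion)
    (h : Disjoint (agree I J) (agree I K)) :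
    min (perpRadius I a J) (perpRadius I a K) ≤ radius a := by
  obtain ⟨C, hC⟩ := norm_le_of_disjoint h
  exact min_rootRadius_le (fun _ => norm_nonneg _) (fun _ => norm_nonneg _)
    (fun _ => norm_nonneg _) fun n => hC (a n)

/-! ### The terms of the series on a slice -/

/-- The action of `z` on the sedenions through the complex structure `L I`. -/
noncomputable def act (I : Sedenion) (z : ℂ) : Module.End ℝ Sedenion := z.re • 1 + z.im • L I

theorem act_apply (I : Sedenion) (z : ℂ) (v : Sedenion) :
    act I z v = z.re • v + z.im • (I * v) := rfl

theorem L_Ψ (I : Sedenion) (z : ℂ) : L (Ψ I z) = act I z := by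
  ext1 v
  rw [L_apply, act_apply, Ψ, IsBilin.right_distrib, IsBilin.smul_mul, IsBilin.smul_mul,
    IsConj.one_mul]

theorem act_one (I : Sedenion) : act I 1 = 1 := by
  simp [act]

theorem act_mul {I : Sedenion} (hI : I ∈ sliceUnits) (z w : ℂ) :
    act I (z * w) = act I z * act I w := by
  have h : L I * L I = -1 := hI
  simp only [act, Complex.mul_re, Complex.mul_im, mul_add, add_mul, smul_mul_smul_comm, one_mul,
    mul_one, h]
  module

theorem act_sub (I : Sedenion) (z w : ℂ) : act I (z - w) = act I z - act I w := by
  simp only [act, Complex.sub_re, Complex.sub_im]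
  module

theorem norm_act {I : Sedenion} (hI : I ∈ sliceUnits) (z : ℂ) (v : Sedenion) :
    ‖act I z v‖ = ‖z‖ * ‖v‖ := by
  have h0 : (inner ℝ v (I * v) : ℝ) = 0 := by
    have := inner_unit_mul hI v v
    rw [real_inner_comm] at this
    linarith
  have h : ‖act I z v‖ ^ 2 = (‖z‖ * ‖v‖) ^ 2 := by
    rw [act_apply, norm_add_sq_real, inner_smul_left, inner_smul_right, h0, norm_smul, norm_smul,
      norm_unit_mul hI, mul_pow ‖z‖, Complex.sq_norm, Complex.normSq_apply, mul_pow, mul_pow,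
      Real.norm_eq_abs, Real.norm_eq_abs, sq_abs, sq_abs]
    ring
  exact (sq_eq_sq₀ (norm_nonneg _) (by positivity)).1 h

theorem act_mem_agree {I K v : Sedenion} (hI : I ∈ sliceUnits) (hK : K ∈ sliceUnits) (z : ℂ)
    (hv : v ∈ agree I K) : act I z v ∈ agree I K :=
  add_mem (Submodule.smul_mem _ _ hv) (Submodule.smul_mem _ _ (unit_mul_mem_agree hI hK hv))

theorem act_mem_agree_orthogonal {I K v : Sedenion} (hI : I ∈ sliceUnits) (hK : K ∈ sliceUnits)
    (z : ℂ) (hv : v ∈ (agree I K)ᗮ) : act I z v ∈ (agree I K)ᗮ :=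
  add_mem (Submodule.smul_mem _ _ hv)
    (Submodule.smul_mem _ _ (unit_mul_mem_agree_orthogonal hI hK hv))

/-- The operator `(1 - K I) / 2`. It sends `I`-holomorphic functions to `K`-holomorphic ones. -/
noncomputable def holoPart (I K : Sedenion) : Module.End ℝ Sedenion :=
  (1 / 2 : ℝ) • (1 - L K * L I)

/-- The operator `(1 + K I) / 2`. It sends `I`-antiholomorphic functions to `K`-holomorphic
ones, and vanishes exactly where `I` and `K` agree. -/
noncomputable def antiPart (I K : Sedenion) : Module.End ℝ Sedenion :=
  (1 / 2 : ℝ) • (1 + L K * L I)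

theorem holoPart_apply (I K v : Sedenion) :
    holoPart I K v = (1 / 2 : ℝ) • (v - K * (I * v)) := rfl

theorem antiPart_apply (I K v : Sedenion) :
    antiPart I K v = (1 / 2 : ℝ) • (v + K * (I * v)) := rfl

theorem starEval_add (f g : (Module.End ℝ Sedenion)[X]) (q : Sedenion) :
    starEval (f + g) q = starEval f q + starEval g q :=
  Polynomial.sum_add_index f g _ (fun _ => mul_zero _) fun _ _ _ => mul_add _ _ _

theorem starEval_sub (f g : (Module.End ℝ Sedenion)[X]) (q : Sedenion) :
    starEval (f - g) q = starEval f q - starEval g q := by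
  rw [eq_sub_iff_add_eq, ← starEval_add, sub_add_cancel]

theorem starEval_monomial (n : ℕ) (c : Module.End ℝ Sedenion) (q : Sedenion) :
    starEval (Polynomial.monomial n c) q = L q ^ n * c :=
  Polynomial.sum_monomial_index c _ (mul_zero _)

theorem starEval_mul_X_sub_C (f : (Module.End ℝ Sedenion)[X]) (c : Module.End ℝ Sedenion)
    (q : Sedenion) :
    starEval (f * (Polynomial.X - Polynomial.C c)) q = L q * starEval f q - starEval f q * c := by
  induction f using Polynomial.induction_on' with
  | add f g hf hg =>
    rw [add_mul, starEval_add, hf, hg, starEval_add, mul_add, add_mul]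
    abel
  | monomial n b =>
    rw [mul_sub, Polynomial.monomial_mul_X, Polynomial.monomial_mul_C, starEval_sub,
      starEval_monomial, starEval_monomial, starEval_monomial, pow_succ', mul_assoc, mul_assoc]

theorem starPow_succ (p : Sedenion) (n : ℕ) (q : Sedenion) :
    starPow p (n + 1) q = L q * starPow p n q - starPow p n q * L p := by
  rw [starPow, pow_succ, starEval_mul_X_sub_C]
  rfl

theorem starPow_zero (p q : Sedenion) : starPow p 0 q = 1 := by
  rw [starPow, pow_zero, ← Polynomial.monomial_zero_one, starEval_monomial]
  simp

theorem act_mul_holoPart {I K : Sedenion} (hI : I ∈ sliceUnits) (hK : K ∈ sliceUnits) (z : ℂ) :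
    act K z * holoPart I K = holoPart I K * act I z := by
  have h1 : L I * L I = -1 := hI
  have h2 : L K * L K = -1 := hK
  simp only [act, holoPart, mul_add, add_mul, smul_mul_smul_comm, one_mul, mul_one, mul_sub,
    sub_mul, ← mul_assoc, h2]
  simp only [mul_assoc, h1, mul_neg, neg_mul, one_mul, mul_one]
  module

theorem act_mul_antiPart {I K : Sedenion} (hI : I ∈ sliceUnits) (hK : K ∈ sliceUnits) (z : ℂ) :
    act K z * antiPart I K = antiPart I K * act I (starRingEnd ℂ z) := by
  have h1 : L I * L I = -1 := hI
  have h2 : L K * L K = -1 := hK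
  simp only [act, antiPart, mul_add, add_mul, smul_mul_smul_comm, one_mul, mul_one,
    ← mul_assoc, h2, Complex.conj_re, Complex.conj_im]
  simp only [mul_assoc, h1, mul_neg, neg_mul, one_mul, mul_one]
  module

theorem holoPart_add_antiPart (I K : Sedenion) : holoPart I K + antiPart I K = 1 := by
  simp only [holoPart, antiPart]
  module

/-- The `*`-powers on the slice of `K`, in terms of the powers on the slice of the centre. -/
theorem starPow_eq {I K : Sedenion} (hI : I ∈ sliceUnits) (hK : K ∈ sliceUnits) (z₀ w : ℂ)
    (n : ℕ) : starPow (Ψ I z₀) n (Ψ K w) =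
      holoPart I K * act I ((w - z₀) ^ n) +
        antiPart I K * act I ((starRingEnd ℂ w - z₀) ^ n) := by
  induction n with
  | zero =>
    rw [starPow_zero, pow_zero, pow_zero, act_one, mul_one, mul_one, holoPart_add_antiPart]
  | succ n ih =>
    rw [starPow_succ, ih, L_Ψ, L_Ψ, mul_add, ← mul_assoc, act_mul_holoPart hI hK, ← mul_assoc,
      act_mul_antiPart hI hK, pow_succ', pow_succ', sub_mul, sub_mul, act_sub, act_sub,
      mul_comm z₀ ((w - z₀) ^ n), mul_comm z₀ ((starRingEnd ℂ w - z₀) ^ n)]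
    simp only [act_mul hI, mul_sub, add_mul, mul_assoc]
    abel

theorem norm_holoPart_le {I K : Sedenion} (hI : I ∈ sliceUnits) (hK : K ∈ sliceUnits)
    (v : Sedenion) : ‖holoPart I K v‖ ≤ ‖v‖ := by
  rw [holoPart_apply, norm_smul]
  have := norm_sub_le v (K * (I * v))
  rw [norm_unit_mul hK, norm_unit_mul hI] at this
  norm_num
  linarith

theorem norm_antiPart_le {I K : Sedenion} (hI : I ∈ sliceUnits) (hK : K ∈ sliceUnits)
    (v : Sedenion) : ‖antiPart I K v‖ ≤ ‖v‖ := by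
  rw [antiPart_apply, norm_smul]
  have := norm_add_le v (K * (I * v))
  rw [norm_unit_mul hK, norm_unit_mul hI] at this
  norm_num
  linarith

theorem antiPart_eq_zero_iff {I K : Sedenion} (hK : K ∈ sliceUnits) {v : Sedenion} :
    antiPart I K v = 0 ↔ v ∈ agree I K := by
  rw [antiPart_apply, smul_eq_zero, or_iff_right (by norm_num), mem_agree]
  constructor
  · intro h
    have h1 := congrArg (fun x => K * x) h
    simp only [IsBilin.left_distrib, mem_sliceUnits.1 hK, mul_zero'] at h1
    exact (add_neg_eq_zero.1 h1).symm
  · intro h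
    rw [h, mem_sliceUnits.1 hK, add_neg_cancel]

theorem holoPart_of_mem {I K : Sedenion} (hK : K ∈ sliceUnits) {v : Sedenion}
    (hv : v ∈ agree I K) : holoPart I K v = v := by
  have h := congrArg (fun f => f v) (holoPart_add_antiPart I K)
  have h1 : holoPart I K v + antiPart I K v = v := h
  rwa [(antiPart_eq_zero_iff hK).2 hv, add_zero] at h1

theorem antiPart_mem {I K : Sedenion} (hI : I ∈ sliceUnits) (hK : K ∈ sliceUnits)
    (v : Sedenion) : antiPart I K v ∈ (agree I K)ᗮ := by
  rw [Submodule.mem_orthogonal']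
  intro u hu
  rw [antiPart_apply, inner_smul_left, inner_add_left, inner_unit_mul hK, ← mem_agree.1 hu,
    inner_unit_mul hI, mem_sliceUnits.1 hI, inner_neg_right]
  simp

theorem holoPart_mem {I K : Sedenion} (hI : I ∈ sliceUnits) (hK : K ∈ sliceUnits)
    {v : Sedenion} (hv : v ∈ (agree I K)ᗮ) : holoPart I K v ∈ (agree I K)ᗮ := by
  have h := congrArg (fun f => f v) (holoPart_add_antiPart I K)
  have h1 : holoPart I K v + antiPart I K v = v := h
  rw [eq_sub_of_add_eq h1]
  exact sub_mem hv (antiPart_mem hI hK v)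

/-- A linear map which is injective on a subspace is bounded below there. -/
theorem exists_norm_le_of_injOn {V : Type*} [NormedAddCommGroup V] [InnerProductSpace ℝ V]
    [FiniteDimensional ℝ V] (f : V →ₗ[ℝ] V) (S : Submodule ℝ V)
    (h : ∀ v ∈ S, f v = 0 → v = 0) : ∃ C : ℝ, 0 ≤ C ∧ ∀ v ∈ S, ‖v‖ ≤ C * ‖f v‖ := by
  have hker : LinearMap.ker (f.domRestrict S) = ⊥ :=
    (Submodule.eq_bot_iff _).2 fun v hv => Subtype.ext (h v v.2 (LinearMap.mem_ker.1 hv))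
  obtain ⟨C, -, hC⟩ := LinearMap.exists_antilipschitzWith _ hker
  refine ⟨C, C.2, fun v hv => ?_⟩
  have := hC.le_mul_dist ⟨v, hv⟩ 0
  rwa [map_zero, dist_zero_right, dist_zero_right] at this

theorem exists_norm_le_antiPart {I K : Sedenion} (hK : K ∈ sliceUnits) :
    ∃ C : ℝ, 0 ≤ C ∧ ∀ v ∈ (agree I K)ᗮ, ‖v‖ ≤ C * ‖antiPart I K v‖ := by
  refine exists_norm_le_of_injOn (antiPart I K) (agree I K)ᗮ fun v hv h => ?_
  rw [antiPart_eq_zero_iff hK] at h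
  have h1 : (inner ℝ v v : ℝ) = 0 := Submodule.inner_right_of_mem_orthogonal h hv
  exact inner_self_eq_zero.1 h1

section term

variable {I K : Sedenion} {p q : SliceCone} {z₀ w : ℂ}

theorem term_eq (hI : I ∈ sliceUnits) (hK : K ∈ sliceUnits)
    (hp : (p : Sedenion) = Ψ I z₀) (hq : (q : Sedenion) = Ψ K w) (a : ℕ → Sedenion) (n : ℕ) :
    term p a n q = holoPart I K (act I ((w - z₀) ^ n) (a n)) +
      antiPart I K (act I ((starRingEnd ℂ w - z₀) ^ n) (a n)) := by
  rw [term, hp, hq, starPow_eq hI hK, LinearMap.add_apply, Module.End.mul_apply,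
    Module.End.mul_apply]

theorem antiPart_act_perp (hI : I ∈ sliceUnits) (hK : K ∈ sliceUnits) (z : ℂ) (v : Sedenion) :
    antiPart I K (act I z v) = antiPart I K (act I z (perp I K v)) := by
  rw [← sub_eq_zero, ← map_sub, ← map_sub, antiPart_eq_zero_iff hK]
  exact act_mem_agree hI hK z (sub_perp_mem I K v)

theorem norm_term_le (hI : I ∈ sliceUnits) (hK : K ∈ sliceUnits)
    (hp : (p : Sedenion) = Ψ I z₀) (hq : (q : Sedenion) = Ψ K w) (a : ℕ → Sedenion) (n : ℕ) :
    ‖term p a n q‖ ≤ dist w z₀ ^ n * ‖a n‖ +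
      dist (starRingEnd ℂ w) z₀ ^ n * ‖perp I K (a n)‖ := by
  rw [term_eq hI hK hp hq, antiPart_act_perp hI hK]
  refine (norm_add_le _ _).trans (add_le_add ?_ ?_)
  · refine (norm_holoPart_le hI hK _).trans_eq ?_
    rw [norm_act hI, norm_pow, dist_eq_norm]
  · refine (norm_antiPart_le hI hK _).trans_eq ?_
    rw [norm_act hI, norm_pow, dist_eq_norm]

/-- On the slice of the centre, the series is an ordinary power series. -/
theorem norm_term_same (hI : I ∈ sliceUnits)
    (hp : (p : Sedenion) = Ψ I z₀) (hq : (q : Sedenion) = Ψ I w) (a : ℕ → Sedenion) (n : ℕ) :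
    ‖term p a n q‖ = dist w z₀ ^ n * ‖a n‖ := by
  have hag (v : Sedenion) : v ∈ agree I I := mem_agree.2 rfl
  rw [term_eq hI hI hp hq, holoPart_of_mem hI (hag _), (antiPart_eq_zero_iff hI).2 (hag _),
    add_zero, norm_act hI, norm_pow, dist_eq_norm]

/-- If the terms are bounded at a point, at which the antiholomorphic part dominates, then both
parts are bounded: the terms split orthogonally into a part in the space on which `I` and `K`
agree and a part orthogonal to it, which controls the distance of the coefficients to that
space. -/
theorem le_radius_of_bounded (hI : I ∈ sliceUnits) (hK : K ∈ sliceUnits)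
    (hp : (p : Sedenion) = Ψ I z₀) (hq : (q : Sedenion) = Ψ K w) {a : ℕ → Sedenion} {M : ℝ}
    (hM : ∀ n, ‖term p a n q‖ ≤ M) (hlt : dist w z₀ < dist (starRingEnd ℂ w) z₀) :
    edist w z₀ ≤ radius a ∧ edist (starRingEnd ℂ w) z₀ ≤ perpRadius I a K := by
  obtain ⟨C, hC0, hC⟩ := exists_norm_le_antiPart (I := I) hK
  set r := dist w z₀ with hr
  set s := dist (starRingEnd ℂ w) z₀ with hs
  have hr0 : 0 ≤ r := dist_nonneg
  have hs0 : 0 < s := hr0.trans_lt hlt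
  have hsplit (n : ℕ) : s ^ n * ‖perp I K (a n)‖ ≤ C * (M + r ^ n * ‖perp I K (a n)‖) ∧
      r ^ n * ‖a n - perp I K (a n)‖ ≤ M := by
    set e := perp I K (a n) with he
    set k := a n - e with hk
    set X := holoPart I K (act I ((w - z₀) ^ n) e) with hX
    set Y := antiPart I K (act I ((starRingEnd ℂ w - z₀) ^ n) e) with hY
    set Z := act I ((w - z₀) ^ n) k with hZ
    have hkm : k ∈ agree I K := sub_perp_mem I K (a n)
    have hZm : Z ∈ agree I K := act_mem_agree hI hK _ hkm
    have hem : e ∈ (agree I K)ᗮ := perp_mem I K (a n)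
    have hXm : X ∈ (agree I K)ᗮ := holoPart_mem hI hK (act_mem_agree_orthogonal hI hK _ hem)
    have hXYm : X + Y ∈ (agree I K)ᗮ := add_mem hXm (antiPart_mem hI hK _)
    have hT : term p a n q = Z + (X + Y) := by
      rw [term_eq hI hK hp hq, antiPart_act_perp hI hK]
      have : a n = k + e := by rw [hk, sub_add_cancel]
      nth_rw 1 [this]
      rw [map_add, map_add, holoPart_of_mem hK hZm, add_assoc]
    have hpyth : ‖term p a n q‖ * ‖term p a n q‖ = ‖Z‖ * ‖Z‖ + ‖X + Y‖ * ‖X + Y‖ := by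
      rw [hT]
      exact norm_add_sq_eq_norm_sq_add_norm_sq_real (hXYm Z hZm)
    have hM0 : 0 ≤ M := (norm_nonneg _).trans (hM n)
    have hTT : ‖term p a n q‖ * ‖term p a n q‖ ≤ M * M :=
      mul_self_le_mul_self (norm_nonneg _) (hM n)
    have hZn : ‖Z‖ ≤ M := abs_le_of_sq_le_sq' (by nlinarith [mul_self_nonneg ‖X + Y‖]) hM0 |>.2
    have hXYn : ‖X + Y‖ ≤ M := abs_le_of_sq_le_sq' (by nlinarith [mul_self_nonneg ‖Z‖]) hM0 |>.2
    constructor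
    · have h1 := hC _ (act_mem_agree_orthogonal hI hK ((starRingEnd ℂ w - z₀) ^ n) hem)
      rw [norm_act hI, norm_pow, ← dist_eq_norm] at h1
      refine h1.trans (mul_le_mul_of_nonneg_left ?_ hC0)
      have h2 : ‖Y‖ ≤ ‖X + Y‖ + ‖X‖ := by
        have := norm_sub_le (X + Y) X
        rwa [add_sub_cancel_left] at this
      have h3 : ‖X‖ ≤ r ^ n * ‖e‖ := by
        refine (norm_holoPart_le hI hK _).trans_eq ?_
        rw [norm_act hI, norm_pow, ← dist_eq_norm]
      linarith
    · rw [hZ, norm_act hI, norm_pow, ← dist_eq_norm] at hZn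
      exact hZn
  have hlim : Tendsto (fun n : ℕ => C * (r / s) ^ n) atTop (𝓝 0) := by
    simpa using (tendsto_pow_atTop_nhds_zero_of_lt_one (by positivity)
      ((div_lt_one hs0).2 hlt)).const_mul C
  have hev : ∀ᶠ n in atTop, s ^ n * ‖perp I K (a n)‖ ≤ 2 * C * M := by
    filter_upwards [hlim.eventually_le_const (show (0 : ℝ) < 1 / 2 by norm_num)] with n hn
    have h1 := (hsplit n).1
    have h2 : C * r ^ n ≤ 1 / 2 * s ^ n := by
      rw [div_pow, mul_div_assoc', div_le_iff₀ (by positivity)] at hn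
      exact hn
    have h3 := mul_le_mul_of_nonneg_right h2 (norm_nonneg (perp I K (a n)))
    linarith
  rw [edist_dist, edist_dist]
  constructor
  · refine le_rootRadius_of_bounded (M := M + 2 * C * M) (fun _ => norm_nonneg _) ?_
    filter_upwards [hev] with n hn
    have h1 := (hsplit n).2
    have h2 : r ^ n * ‖perp I K (a n)‖ ≤ s ^ n * ‖perp I K (a n)‖ := by gcongr
    have h3 : ‖a n‖ ≤ ‖a n - perp I K (a n)‖ + ‖perp I K (a n)‖ := by
      have := norm_add_le (a n - perp I K (a n)) (perp I K (a n))
      rwa [sub_add_cancel] at this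
    have h4 := mul_le_mul_of_nonneg_left h3 (pow_nonneg hr0 n)
    linarith
  · exact le_rootRadius_of_bounded (fun _ => norm_nonneg _) hev

theorem le_radius_of_bounded_same (hI : I ∈ sliceUnits)
    (hp : (p : Sedenion) = Ψ I z₀) (hq : (q : Sedenion) = Ψ I w) {a : ℕ → Sedenion} {M : ℝ}
    (hM : ∀ n, ‖term p a n q‖ ≤ M) : edist w z₀ ≤ radius a := by
  rw [edist_dist]
  refine le_rootRadius_of_bounded (M := M) (fun _ => norm_nonneg _) (.of_forall fun n => ?_)
  rw [← norm_term_same hI hp hq]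
  exact hM n

theorem summable_pow_mul {u : ℕ → ℝ} (hu : ∀ n, 0 ≤ u n) {z w : ℂ}
    (h : edist z w < rootRadius u) : Summable fun n => dist z w ^ n * u n :=
  summable_of_lt_rootRadius hu dist_nonneg (by rwa [← edist_dist])

/-- Absolute convergence; at the centre `z₀` the first part of the series is finite. -/
theorem summable_term (hI : I ∈ sliceUnits) (hK : K ∈ sliceUnits)
    (hp : (p : Sedenion) = Ψ I z₀) (hq : (q : Sedenion) = Ψ K w) {a : ℕ → Sedenion}
    (h₁ : w ∈ ballStar z₀ (radius a)) (h₂ : edist (starRingEnd ℂ w) z₀ < perpRadius I a K) :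
    Summable fun n => ‖term p a n q‖ := by
  refine Summable.of_nonneg_of_le (fun _ => norm_nonneg _)
    (fun n => norm_term_le hI hK hp hq a n)
    (Summable.add ?_ (summable_pow_mul (fun _ => norm_nonneg _) h₂))
  rcases h₁ with h | rfl
  · exact summable_pow_mul (fun _ => norm_nonneg _) h
  · refine summable_of_ne_finset_zero (s := {0}) fun n hn => ?_
    rw [Finset.mem_singleton] at hn
    rw [dist_self, zero_pow hn, zero_mul]

theorem exists_bound_of_tendsto {a : ℕ → Sedenion}
    (h : ∃ s, Tendsto (fun N => partialSum p a N q) atTop (𝓝 s)) :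
    ∃ M, ∀ n, ‖term p a n q‖ ≤ M := by
  obtain ⟨s, hs⟩ := h
  have h1 := (hs.comp (tendsto_add_atTop_nat 1)).sub hs
  have h2 : Tendsto (fun n => term p a n q) atTop (𝓝 0) := by
    rw [sub_self] at h1
    refine h1.congr fun n => ?_
    simp only [Function.comp, partialSum, Finset.sum_range_succ, add_sub_cancel_left]
  obtain ⟨M, hM⟩ := h2.norm.bddAbove_range
  exact ⟨M, fun n => hM ⟨n, rfl⟩⟩

end term

/-! ### Coordinates on the slice cone -/

theorem Ψ_eq_act (K : Sedenion) (w : ℂ) : Ψ K w = act K w 1 := by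
  rw [act_apply, IsConj.mul_one, Ψ]

theorem Ψ_sub (K : Sedenion) (z w : ℂ) : Ψ K z - Ψ K w = Ψ K (z - w) := by
  simp only [Ψ, Complex.sub_re, Complex.sub_im]
  module

theorem edist_Ψ {K : Sedenion} (hK : K ∈ sliceUnits) (z w : ℂ) :
    edist (Ψ K z) (Ψ K w) = edist z w := by
  rw [edist_dist, edist_dist, dist_eq_norm, dist_eq_norm, Ψ_sub, Ψ_eq_act, norm_act hK,
    norm_one_sedenion, mul_one]

theorem Ψ_injective {K : Sedenion} (hK : K ∈ sliceUnits) : Function.Injective (Ψ K) :=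
  fun z w h => edist_eq_zero.1 (by rw [← edist_Ψ hK, h, edist_self])

theorem Ψ_neg_conj (K : Sedenion) (w : ℂ) : Ψ (-K) (starRingEnd ℂ w) = Ψ K w := by
  simp only [Ψ, Complex.conj_re, Complex.conj_im, neg_smul_neg]

theorem Ψ_of_im_eq_zero {w : ℂ} (hw : w.im = 0) (K K' : Sedenion) : Ψ K w = Ψ K' w := by
  simp only [Ψ, hw, zero_smul]

theorem inner_Ψ_one {K : Sedenion} (hK : K ∈ sliceUnits) (w : ℂ) :
    inner ℝ (Ψ K w) (1 : Sedenion) = w.re := by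
  rw [Ψ, inner_add_left, inner_smul_left, inner_smul_left, IsConj.inner_one_one,
    inner_unit_one hK]
  simp

theorem Ψ_eq_iff {K K' : Sedenion} (hK : K ∈ sliceUnits) (hK' : K' ∈ sliceUnits) {w w' : ℂ}
    (h : Ψ K w = Ψ K' w') :
    (w = w' ∧ (K = K' ∨ w.im = 0)) ∨ (w' = starRingEnd ℂ w ∧ K' = -K) := by
  have hre : w.re = w'.re := by rw [← inner_Ψ_one hK, h, inner_Ψ_one hK']
  have him : w.im • K = w'.im • K' := by
    have := h
    rw [Ψ, Ψ, hre] at this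
    exact add_left_cancel this
  have habs : |w.im| = |w'.im| := by
    have := congrArg norm him
    rwa [norm_smul, norm_smul, norm_unit hK, norm_unit hK', mul_one, mul_one] at this
  rcases eq_or_ne w.im 0 with h0 | h0
  · left
    have h0' : w'.im = 0 := by rwa [h0, abs_zero, eq_comm, abs_eq_zero] at habs
    exact ⟨Complex.ext hre (h0.trans h0'.symm), Or.inr h0⟩
  · rcases abs_eq_abs.1 habs with h1 | h1
    · left
      refine ⟨Complex.ext hre h1, Or.inl ?_⟩
      rw [← h1] at him
      exact smul_right_injective _ h0 him
    · right
      refine ⟨Complex.ext (by simp [hre]) (by simp [h1]), ?_⟩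
      rw [h1, neg_smul, ← smul_neg] at him
      exact (smul_right_injective _ (fun h2 => h0 (by rw [h1, h2, neg_zero])) him).symm

theorem exists_Ψ (q : SliceCone) :
    ∃ K ∈ sliceUnits, ∃ w : ℂ, 0 ≤ w.im ∧ (q : Sedenion) = Ψ K w := by
  obtain ⟨K, hK, w, hw⟩ := q.2
  rcases le_total 0 w.im with h | h
  · exact ⟨K, hK, w, h, hw⟩
  · exact ⟨-K, neg_mem_sliceUnits hK, starRingEnd ℂ w, by simpa using h, by
      rw [Ψ_neg_conj]; exact hw⟩

theorem isRealPt_Ψ_iff {K : Sedenion} (hK : K ∈ sliceUnits) (w : ℂ) :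
    IsRealPt (Ψ K w) ↔ w.im = 0 := by
  constructor
  · rintro ⟨x, hx⟩
    have h : Ψ K w = Ψ K (x : ℂ) := by rw [hx]; simp [Ψ]
    rw [Ψ_injective hK h, Complex.ofReal_im]
  · intro h
    exact ⟨w.re, by simp [Ψ, h]⟩

/-- The coordinates of a point. -/
theorem point_coordinates {I₀ : Sedenion} (hI₀ : I₀ ∈ sliceUnits) (p : SliceCone) :
    unitPt I₀ p ∈ sliceUnits ∧ (p : Sedenion) = Ψ (unitPt I₀ p) (zPt I₀ p) ∧ 0 ≤ imPt I₀ p ∧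
      (IsRealPt (p : Sedenion) ↔ imPt I₀ p = 0) := by
  obtain ⟨K, hK, w, hw0, hw⟩ := exists_Ψ p
  have hre : rePt (p : Sedenion) = w.re := by rw [rePt, hw, inner_Ψ_one hK]
  by_cases hreal : IsRealPt (p : Sedenion)
  · have hu : unitPt I₀ (p : Sedenion) = I₀ := if_pos hreal
    have hw1 : w.im = 0 := by rwa [hw, isRealPt_Ψ_iff hK] at hreal
    have him : imPt I₀ (p : Sedenion) = 0 := by
      rw [imPt, hu, hw, Ψ, hw1, zero_smul, add_zero, inner_smul_left, real_inner_comm,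
        inner_unit_one hI₀, mul_zero]
    refine ⟨by rw [hu]; exact hI₀, ?_, him.ge, by simp [hreal, him]⟩
    have hz : zPt I₀ (p : Sedenion) = w := Complex.ext hre (him.trans hw1.symm)
    rw [hz, hw]
    exact Ψ_of_im_eq_zero hw1 _ _
  · have hw1 : 0 < w.im := lt_of_le_of_ne hw0 fun h =>
      hreal (by rw [hw, isRealPt_Ψ_iff hK]; exact h.symm)
    have hu : unitPt I₀ (p : Sedenion) = K := by
      rw [unitPt, if_neg hreal, hre, hw, Ψ, add_sub_cancel_left, norm_smul, norm_unit hK,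
        mul_one, Real.norm_of_nonneg hw0, smul_smul, inv_mul_cancel₀ hw1.ne', one_smul]
    have him : imPt I₀ (p : Sedenion) = w.im := by
      rw [imPt, hu, hw, Ψ, inner_add_left, inner_smul_left, inner_smul_left, real_inner_comm,
        inner_unit_one hK, real_inner_self_eq_norm_sq, norm_unit hK]
      simp
    have hz : zPt I₀ (p : Sedenion) = w := Complex.ext hre him
    refine ⟨hu ▸ hK, by rw [hu, hz, hw], him ▸ hw0, ?_⟩
    simp [hreal, him, hw1.ne']

/-! ### Hyper-solutions -/

theorem mem_unitsKer_pair {I J K : Sedenion} :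
    K ∈ unitsKer ![I, J] ↔ K ∈ sliceUnits ∧ agree I J ≤ agree I K := by
  refine and_congr_right fun _ => ?_
  constructor
  · intro h v hv
    rw [mem_agree] at *
    have h1 : ((-(I * v), v) : Sedenion × Sedenion) ∈ kerOne K := by
      refine h (Set.mem_iInter.2 fun l => ?_)
      fin_cases l
      · exact neg_add_cancel (I * v)
      · change -(I * v) + J * v = 0
        rw [hv, neg_add_cancel]
    have h2 : -(I * v) + K * v = 0 := h1
    exact neg_add_eq_zero.1 h2
  · intro h v hv
    rw [Set.mem_iInter] at hv
    have h1 : v.1 + I * v.2 = 0 := hv 0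
    have h2 : v.1 + J * v.2 = 0 := hv 1
    have h3 : v.2 ∈ agree I J := mem_agree.2 (add_left_cancel (h1.trans h2.symm))
    have h4 := mem_agree.1 (h h3)
    change v.1 + K * v.2 = 0
    rw [← h4, h1]

theorem self_mem_unitsKer {I J : Sedenion} (hI : I ∈ sliceUnits) : I ∈ unitsKer ![I, J] :=
  mem_unitsKer_pair.2 ⟨hI, by rw [agree_self]; exact le_top⟩

theorem neg_not_mem_unitsKer {I J : Sedenion} (hI : I ∈ sliceUnits) (h : agree I J ≠ ⊥) :
    -I ∉ unitsKer ![I, J] := fun h1 => by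
  have := (mem_unitsKer_pair.1 h1).2
  rw [agree_neg hI, le_bot_iff] at this
  exact h this

theorem isHyperSolution_pair {I J : Sedenion} (hI : I ∈ sliceUnits) (hJ : J ∈ sliceUnits)
    (hIJ : I ≠ J) (h : agree I J ≠ ⊥) : IsHyperSolution ![I, J] := by
  have hunits : ∀ l, (![I, J] : Fin 2 → Sedenion) l ∈ sliceUnits := by
    intro l
    fin_cases l
    · exact hI
    · exact hJ
  refine ⟨hunits, fun hs => neg_not_mem_unitsKer hI h (hs.2 ▸ neg_mem_sliceUnits hI), ?_⟩
  rintro K ⟨hK, hKn⟩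
  have hIK : I ≠ K := fun h => hKn (h ▸ self_mem_unitsKer hI)
  have hdisj : Disjoint (agree I J) (agree I K) :=
    (agree_eq_or_disjoint hI hJ hK hIJ hIK).resolve_left fun he =>
      hKn (mem_unitsKer_pair.2 ⟨hK, he.le⟩)
  refine ⟨fun l => ?_, ?_⟩
  · induction l using Fin.lastCases with
    | last => simpa using hK
    | cast l => simpa using hunits l
  · refine Set.Subset.antisymm (fun K' h => h.1) fun K' hK' => ⟨hK', fun v hv => ?_⟩
    rw [Set.mem_iInter] at hv
    have h1 : v.1 + I * v.2 = 0 := hv 0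
    have h2 : v.1 + J * v.2 = 0 := hv 1
    have h3 : v.1 + K * v.2 = 0 := hv 2
    have h4 : v.2 ∈ agree I J := mem_agree.2 (add_left_cancel (h1.trans h2.symm))
    have h5 : v.2 ∈ agree I K := mem_agree.2 (add_left_cancel (h1.trans h3.symm))
    have h6 : v.2 = 0 := Submodule.disjoint_def.1 hdisj _ h4 h5
    rw [h6, mul_zero', add_zero] at h1
    change v.1 + K' * v.2 = 0
    rw [h6, h1, mul_zero', add_zero]

/-! ### The two convergence radii -/

theorem radiusAt_of_real {I₀ p : Sedenion} (hp : IsRealPt p) (a : ℕ → Sedenion) (K : Sedenion) :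
    radiusAt I₀ p a K = radius a := if_pos (Or.inl hp)

theorem radiusAt_unitPt (I₀ p : Sedenion) (a : ℕ → Sedenion) :
    radiusAt I₀ p a (unitPt I₀ p) = radius a := if_pos (Or.inr rfl)

theorem radiusAt_of_ne {I₀ p : Sedenion} (hp : ¬IsRealPt p) (a : ℕ → Sedenion) {K : Sedenion}
    (hK : unitPt I₀ p ≠ K) : radiusAt I₀ p a K = perpRadius (unitPt I₀ p) a K := by
  rw [radiusAt, if_neg (not_or.2 ⟨hp, hK.symm⟩)]
  simp only [infDist_agree]
  rfl

theorem radius_le_radiusAt (I₀ p : Sedenion) (a : ℕ → Sedenion) (K : Sedenion) :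
    radius a ≤ radiusAt I₀ p a K := by
  by_cases h : IsRealPt p ∨ K = unitPt I₀ p
  · exact (if_pos h).ge
  · rw [not_or] at h
    rw [radiusAt_of_ne h.1 a (Ne.symm h.2)]
    exact radius_le_perpRadius _ _ _

theorem radiusAt_le_radiusSup {I₀ p : Sedenion} (a : ℕ → Sedenion) {K : Sedenion}
    (hK : K ∈ sliceUnits) : radiusAt I₀ p a K ≤ radiusSup I₀ p a :=
  le_iSup₂ (f := fun K (_ : K ∈ sliceUnits) => radiusAt I₀ p a K) K hK

theorem radius_le_radiusSup {I₀ p K : Sedenion} (hK : K ∈ sliceUnits) (a : ℕ → Sedenion) :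
    radius a ≤ radiusSup I₀ p a :=
  (radius_le_radiusAt I₀ p a K).trans (radiusAt_le_radiusSup a hK)

theorem perpRadius_le_radiusSup {I₀ p : Sedenion} (hp : ¬IsRealPt p) (a : ℕ → Sedenion)
    {K : Sedenion} (hK : K ∈ sliceUnits) (hne : unitPt I₀ p ≠ K) :
    perpRadius (unitPt I₀ p) a K ≤ radiusSup I₀ p a := by
  rw [← radiusAt_of_ne hp a hne]
  exact radiusAt_le_radiusSup a hK

/-- A slice unit `J` with radius larger than `R_a` agrees with `I_p` on a nonzero space, and the
radii of all slice units outside the hyper-solution `(I_p, J)` are `R_a`. -/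
theorem large_radius {I₀ p : Sedenion} (hI : unitPt I₀ p ∈ sliceUnits) {a : ℕ → Sedenion}
    {J : Sedenion} (hJ : J ∈ sliceUnits) (h : radius a < radiusAt I₀ p a J) :
    ¬IsRealPt p ∧ unitPt I₀ p ≠ J ∧ agree (unitPt I₀ p) J ≠ ⊥ ∧
      perpRadius (unitPt I₀ p) a J = radiusAt I₀ p a J ∧
      ∀ K ∈ sliceUnits, K ∉ unitsKer ![unitPt I₀ p, J] →
        perpRadius (unitPt I₀ p) a K ≤ radius a := by
  have hp : ¬IsRealPt p := fun hp => h.ne (radiusAt_of_real hp a J).symm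
  have hne : unitPt I₀ p ≠ J := fun hne => h.ne (by rw [← hne, radiusAt_unitPt])
  have hJr := radiusAt_of_ne hp a hne
  rw [hJr] at h
  have small {K : Sedenion} (hd : Disjoint (agree (unitPt I₀ p) J) (agree (unitPt I₀ p) K)) :
      perpRadius (unitPt I₀ p) a K ≤ radius a :=
    (min_le_iff.1 (min_perpRadius_le a hd)).resolve_left h.not_ge
  refine ⟨hp, hne, fun hbot => ?_, hJr.symm, fun K hK hKn => small ?_⟩
  · exact h.not_ge (small (by rw [hbot]; exact disjoint_bot_left))
  · exact (agree_eq_or_disjoint hI hJ hK hne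
      fun h => hKn (h ▸ self_mem_unitsKer hI)).resolve_left fun he =>
        hKn (mem_unitsKer_pair.2 ⟨hK, he.le⟩)

/-- The supremum of the radii is attained, because they take at most one value besides `R_a`. -/
theorem exists_radiusAt_eq_radiusSup {I₀ p : Sedenion} (hI₀ : I₀ ∈ sliceUnits)
    (hI : unitPt I₀ p ∈ sliceUnits) (a : ℕ → Sedenion) :
    ∃ J ∈ sliceUnits, radiusAt I₀ p a J = radiusSup I₀ p a := by
  by_cases h : ∃ J ∈ sliceUnits, radius a < radiusAt I₀ p a J
  · obtain ⟨J, hJ, hlt⟩ := h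
    obtain ⟨hp, hne, -, hJr, hsmall⟩ := large_radius hI hJ hlt
    refine ⟨J, hJ, le_antisymm (radiusAt_le_radiusSup a hJ) (iSup₂_le fun K hK => ?_)⟩
    by_cases hIK : unitPt I₀ p = K
    · rw [← hIK, radiusAt_unitPt]
      exact hlt.le
    rw [radiusAt_of_ne hp a hIK]
    by_cases hKJ : K ∈ unitsKer ![unitPt I₀ p, J]
    · by_cases hd : Disjoint (agree (unitPt I₀ p) J) (agree (unitPt I₀ p) K)
      · have := min_perpRadius_le a hd
        rw [hJr] at this
        exact ((min_le_iff.1 this).resolve_left hlt.not_ge).trans hlt.le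
      · have he := (agree_eq_or_disjoint hI hJ hK hne hIK).resolve_right hd
        rw [← hJr]
        exact perpRadius_mono a he.ge
    · exact (hsmall K hK hKJ).trans hlt.le
  · push Not at h
    refine ⟨I₀, hI₀, le_antisymm (radiusAt_le_radiusSup a hI₀) (iSup₂_le fun K hK => ?_)⟩
    exact (h K hK).trans (radius_le_radiusAt _ _ _ _)

/-! ### Slice regularity of the sum -/

/-- Slice regularity at the point `x + y K`, on the slice of `K`. -/
def RegularAt (f : SliceCone → Sedenion) (K : sliceUnits) (z : ℂ) : Prop :=
  DifferentiableAt ℝ (fun w : ℂ => f (toCone K w)) z ∧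
    (1 / 2 : ℝ) • (fderiv ℝ (fun w : ℂ => f (toCone K w)) z 1 +
      L K.1 (fderiv ℝ (fun w : ℂ => f (toCone K w)) z Complex.I)) = 0

/-- The slice unit `-K`. -/
noncomputable def negUnit (K : sliceUnits) : sliceUnits := ⟨-K.1, neg_mem_sliceUnits K.2⟩

theorem toCone_negUnit (K : sliceUnits) (w : ℂ) :
    toCone (negUnit K) (starRingEnd ℂ w) = toCone K w :=
  Subtype.ext (Ψ_neg_conj K.1 w)

theorem RegularAt.of_neg {f : SliceCone → Sedenion} {K : sliceUnits} {z : ℂ}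
    (h : RegularAt f (negUnit K) (starRingEnd ℂ z)) : RegularAt f K z := by
  set g : ℂ → Sedenion := fun w => f (toCone (negUnit K) w) with hg
  have hfg : (fun w : ℂ => f (toCone K w)) = fun w => g (Complex.conjCLE w) := by
    funext w
    change f (toCone K w) = f (toCone (negUnit K) (starRingEnd ℂ w))
    rw [toCone_negUnit]
  have hd : HasFDerivAt g (fderiv ℝ g (starRingEnd ℂ z)) (Complex.conjCLE z) :=
    h.1.hasFDerivAt
  have hc := hd.comp z Complex.conjCLE.hasFDerivAt
  have hc' : HasFDerivAt (fun w : ℂ => f (toCone K w))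
      ((fderiv ℝ g (starRingEnd ℂ z)).comp Complex.conjCLE.toContinuousLinearMap) z := by
    rw [hfg]; exact hc
  refine ⟨hc'.differentiableAt, ?_⟩
  have h2 := h.2
  rw [hc'.fderiv]
  simp only [ContinuousLinearMap.comp_apply, ContinuousLinearEquiv.coe_coe,
    Complex.conjCLE_apply, map_one, Complex.conj_I, map_neg]
  rw [L_apply] at h2 ⊢
  rw [← h2]
  congr 2
  change -(K.1 * _) = -K.1 * _
  rw [neg_mul']

/-- A power series with coefficients in a complex Banach space is complex differentiable inside its
disc of convergence. -/
theorem hasFDerivAt_powerSeries {E : Type*} [NormedAddCommGroup E] [NormedSpace ℂ E]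
    [NormedSpace ℝ E] [IsScalarTower ℝ ℂ E] [CompleteSpace E] (c : ℕ → E) {z₀ z : ℂ}
    (h : edist z z₀ < rootRadius fun n => ‖c n‖) :
    ∃ v : E, HasFDerivAt (𝕜 := ℝ) (fun w : ℂ => ∑' n, (w - z₀) ^ n • c n)
      ((ContinuousLinearMap.toSpanSingleton ℂ v).restrictScalars ℝ) z := by
  obtain ⟨r, h1, h2⟩ := ENNReal.lt_iff_exists_nnreal_btwn.1 h
  have hz : z ∈ Metric.ball z₀ (r : ℝ) := by
    rw [Metric.mem_ball, dist_edist]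
    exact (ENNReal.toReal_lt_toReal (edist_ne_top _ _) ENNReal.coe_ne_top).2 h1
  have hsum := summable_of_lt_rootRadius (fun _ => norm_nonneg _) r.2
    (show ENNReal.ofReal r < _ by rwa [ENNReal.ofReal_coe_nnreal])
  have hdiff : DifferentiableOn ℂ (fun w : ℂ => ∑' n, (w - z₀) ^ n • c n)
      (Metric.ball z₀ (r : ℝ)) := by
    refine Complex.differentiableOn_tsum_of_summable_norm hsum (fun n => ?_)
      Metric.isOpen_ball fun n w hw => ?_
    · fun_prop
    · rw [norm_smul, norm_pow, ← dist_eq_norm]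
      have : dist w z₀ ≤ r := (Metric.mem_ball.1 hw).le
      exact mul_le_mul_of_nonneg_right (pow_le_pow_left₀ dist_nonneg this n) (norm_nonneg _)
  have hat := (hdiff.differentiableAt (Metric.isOpen_ball.mem_nhds hz)).hasDerivAt
  exact ⟨_, hat.hasFDerivAt.restrictScalars ℝ⟩

/-- The sedenions as a complex vector space, through the complex structure `L I`. -/
noncomputable abbrev complexSpace {I : Sedenion} (hI : I ∈ sliceUnits) :
    NormedSpace ℂ Sedenion where
  smul z v := act I z v
  one_smul v := by
    change act I 1 v = v
    rw [act_one]; rfl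
  mul_smul z w v := by
    change act I (z * w) v = act I z (act I w v)
    rw [act_mul hI]; rfl
  smul_zero z := map_zero (act I z)
  smul_add z := map_add (act I z)
  add_smul z w v := by
    change act I (z + w) v = act I z v + act I w v
    simp only [act_apply, Complex.add_re, Complex.add_im]
    module
  zero_smul v := by
    change act I 0 v = 0
    simp [act_apply]
  norm_smul_le z v := (norm_act hI z v).le

/-- The real derivative `h ↦ h v` of an `I`-holomorphic function of complex derivative `v`. -/
noncomputable def actCLM (I v : Sedenion) : ℂ →L[ℝ] Sedenion :=
  Complex.reCLM.smulRight v + Complex.imCLM.smulRight (I * v)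

theorem actCLM_apply (I v : Sedenion) (z : ℂ) : actCLM I v z = act I z v := rfl

/-- The sum of a power series for the complex structure `L I` is `I`-holomorphic. -/
theorem hasFDerivAt_act {I : Sedenion} (hI : I ∈ sliceUnits) (c : ℕ → Sedenion) {z₀ z : ℂ}
    (h : edist z z₀ < rootRadius fun n => ‖c n‖) :
    ∃ v, HasFDerivAt (fun w : ℂ => ∑' n, act I ((w - z₀) ^ n) (c n)) (actCLM I v) z := by
  have tower : @IsScalarTower ℝ ℂ Sedenion _ (complexSpace hI).toSMul _ := by
    refine @IsScalarTower.mk ℝ ℂ Sedenion _ (complexSpace hI).toSMul _ fun r z v => ?_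
    change act I (r • z) v = r • act I z v
    simp only [act_apply, Complex.smul_re, Complex.smul_im, smul_eq_mul]
    module
  obtain ⟨v, hv⟩ := @hasFDerivAt_powerSeries Sedenion _ (complexSpace hI) _ tower _ c z₀ z h
  refine ⟨v, hv.congr_fderiv ?_⟩
  ext1 z
  rfl

theorem summable_act {I : Sedenion} (hI : I ∈ sliceUnits) (c : ℕ → Sedenion) {z₀ z : ℂ}
    (h : edist z z₀ < rootRadius fun n => ‖c n‖) :
    Summable fun n => act I ((z - z₀) ^ n) (c n) := by
  refine Summable.of_norm ((summable_pow_mul (fun _ => norm_nonneg _) h).congr fun n => ?_)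
  rw [norm_act hI, norm_pow, dist_eq_norm]

/-- A linear operator on a finite-dimensional space, as a continuous one. -/
noncomputable def opCLM {V : Type*} [NormedAddCommGroup V] [NormedSpace ℝ V]
    [FiniteDimensional ℝ V] (T : Module.End ℝ V) : V →L[ℝ] V := LinearMap.toContinuousLinearMap T

theorem opCLM_apply {V : Type*} [NormedAddCommGroup V] [NormedSpace ℝ V]
    [FiniteDimensional ℝ V] (T : Module.End ℝ V) (v : V) : opCLM T v = T v := rfl

theorem P_eq {I : Sedenion} (hI : I ∈ sliceUnits) (K : sliceUnits) {p : SliceCone} {z₀ w : ℂ}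
    (hp : (p : Sedenion) = Ψ I z₀) {a : ℕ → Sedenion} (h₁ : edist w z₀ < radius a)
    (h₂ : edist (starRingEnd ℂ w) z₀ < perpRadius I a K) :
    P p a (toCone K w) =
      opCLM (holoPart I K.1) (∑' n, act I ((w - z₀) ^ n) (a n)) +
        opCLM (antiPart I K.1)
          (∑' n, act I ((starRingEnd ℂ w - z₀) ^ n) (perp I K.1 (a n))) := by
  have s₁ := summable_act hI a h₁
  have s₂ := summable_act hI (fun n => perp I K.1 (a n)) h₂
  rw [ContinuousLinearMap.map_tsum _ s₁, ContinuousLinearMap.map_tsum _ s₂,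
    ← (ContinuousLinearMap.summable _ s₁).tsum_add (ContinuousLinearMap.summable _ s₂), P]
  refine tsum_congr fun n => ?_
  rw [term_eq hI K.2 hp rfl, antiPart_act_perp hI K.2, opCLM_apply, opCLM_apply]

/-- The derivative of `w ↦ A (f w) + B (g (conj w))`, in terms of those of `f` and `g`. -/
noncomputable def splitDeriv {V : Type*} [NormedAddCommGroup V] [NormedSpace ℝ V]
    (A B : V →L[ℝ] V) (f' g' : ℂ →L[ℝ] V) : ℂ →L[ℝ] V :=
  A.comp f' + B.comp (g'.comp Complex.conjCLE.toContinuousLinearMap)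

theorem splitDeriv_apply {V : Type*} [NormedAddCommGroup V] [NormedSpace ℝ V]
    (A B : V →L[ℝ] V) (f' g' : ℂ →L[ℝ] V) (z : ℂ) :
    splitDeriv A B f' g' z = A (f' z) + B (g' (starRingEnd ℂ z)) := rfl

theorem hasFDerivAt_splitDeriv {V : Type*} [NormedAddCommGroup V] [NormedSpace ℝ V]
    (A B : V →L[ℝ] V) {f g h : ℂ → V} {f' g' : ℂ →L[ℝ] V} {z : ℂ} (hf : HasFDerivAt f f' z)
    (hg : HasFDerivAt g g' (starRingEnd ℂ z))
    (hh : ∀ᶠ w in 𝓝 z, h w = A (f w) + B (g (starRingEnd ℂ w))) :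
    HasFDerivAt h (splitDeriv A B f' g') z := by
  have hg' : HasFDerivAt (fun w => g (starRingEnd ℂ w))
      (g'.comp Complex.conjCLE.toContinuousLinearMap) z :=
    HasFDerivAt.comp z (f := fun w => Complex.conjCLE w) hg Complex.conjCLE.hasFDerivAt
  exact ((A.hasFDerivAt.comp z hf).add (B.hasFDerivAt.comp z hg')).congr_of_eventuallyEq hh

theorem add_apply_eq_zero_of_mul {V : Type*} [AddCommGroup V] [Module ℝ V]
    {A B T X Y : Module.End ℝ V} (hA : T * (A * X) = -A) (hB : T * (B * Y) = -B) (v u : V) :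
    A v + B u + T (A (X v) + B (Y u)) = 0 := by
  have h₁ : T (A (X v)) = -A v := congrArg (fun f => f v) hA
  have h₂ : T (B (Y u)) = -B u := congrArg (fun f => f u) hB
  rw [map_add, h₁, h₂]
  abel

/-- Both parts of the derivative satisfy the Cauchy-Riemann equation on the slice of `K`, because
`(1 - K I) / 2` and `(1 + K I) / 2` turn multiplication by `I` and by `-I` into multiplication
by `K`. -/
theorem splitDeriv_cauchyRiemann {I K : Sedenion} (hI : I ∈ sliceUnits) (hK : K ∈ sliceUnits)
    (v u : Sedenion) :
    splitDeriv (opCLM (holoPart I K)) (opCLM (antiPart I K)) (actCLM I v) (actCLM I u) 1 +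
      L K (splitDeriv (opCLM (holoPart I K)) (opCLM (antiPart I K)) (actCLM I v) (actCLM I u)
        Complex.I) = 0 := by
  have hL : L K = act K Complex.I := by simp [act]
  have h₁ : act I (-1) = -1 := by simp [act]
  simp only [splitDeriv_apply, map_one (starRingEnd ℂ), actCLM_apply, opCLM_apply, act_one,
    Module.End.one_apply]
  refine add_apply_eq_zero_of_mul ?_ ?_ v u
  · rw [hL, ← mul_assoc, act_mul_holoPart hI hK, mul_assoc, ← act_mul hI, Complex.I_mul_I, h₁,
      mul_neg, mul_one]
  · rw [hL, ← mul_assoc, act_mul_antiPart hI hK, mul_assoc, ← act_mul hI, Complex.conj_I,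
      neg_mul_neg, Complex.I_mul_I, h₁, mul_neg, mul_one]

theorem hasFDerivAt_P {I : Sedenion} (hI : I ∈ sliceUnits) (K : sliceUnits) {p : SliceCone}
    {z₀ z : ℂ} (hp : (p : Sedenion) = Ψ I z₀) {a : ℕ → Sedenion} (h₁ : edist z z₀ < radius a)
    (h₂ : edist (starRingEnd ℂ z) z₀ < perpRadius I a K) :
    ∃ v u, HasFDerivAt (fun w : ℂ => P p a (toCone K w)) (splitDeriv (opCLM (holoPart I K.1))
      (opCLM (antiPart I K.1)) (actCLM I v) (actCLM I u)) z := by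
  obtain ⟨v, hv⟩ := hasFDerivAt_act hI a h₁
  obtain ⟨u, hu⟩ := hasFDerivAt_act hI (fun n => perp I K.1 (a n)) h₂
  have c₁ : Continuous fun w : ℂ => edist w z₀ := by fun_prop
  have c₂ : Continuous fun w : ℂ => edist (starRingEnd ℂ w) z₀ := by fun_prop
  refine ⟨v, u, hasFDerivAt_splitDeriv _ _ hv hu ?_⟩
  filter_upwards [c₁.continuousAt.eventually_lt_const h₁,
    c₂.continuousAt.eventually_lt_const h₂] with w hw₁ hw₂
  exact P_eq hI K hp hw₁ hw₂

/-- The series is slice regular wherever its holomorphic part and its antiholomorphic part, reduced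
modulo the space on which `I` and `K` agree, both converge. -/
theorem regularAt_P {I : Sedenion} (hI : I ∈ sliceUnits) (K : sliceUnits) {p : SliceCone}
    {z₀ z : ℂ} (hp : (p : Sedenion) = Ψ I z₀) {a : ℕ → Sedenion} (h₁ : edist z z₀ < radius a)
    (h₂ : edist (starRingEnd ℂ z) z₀ < perpRadius I a K) : RegularAt (P p a) K z := by
  obtain ⟨v, u, h⟩ := hasFDerivAt_P hI K hp h₁ h₂
  refine ⟨h.differentiableAt, ?_⟩
  rw [h.fderiv, splitDeriv_cauchyRiemann hI K.2, smul_zero]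

/-! ### The points of the balls -/

theorem edist_conj_right (w z : ℂ) :
    edist w (starRingEnd ℂ z) = edist (starRingEnd ℂ w) z := by
  rw [edist_dist, edist_dist, Complex.dist_conj_comm]

theorem mem_ballStar {z w : ℂ} {r : ℝ≥0∞} : w ∈ ballStar z r ↔ edist w z < r ∨ w = z := Iff.rfl

theorem mem_ballStar_of_pos {z w : ℂ} {r : ℝ≥0∞} (hr : 0 < r) :
    w ∈ ballStar z r ↔ edist w z < r := by
  rw [mem_ballStar, or_iff_left_of_imp]
  rintro rfl
  rwa [edist_self]

theorem mem_ballStar_inter_of_lt {z w : ℂ} {r : ℝ≥0∞} (h₁ : edist w z < r)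
    (h₂ : edist (starRingEnd ℂ w) z < r) :
    w ∈ ballStar z r ∩ ballStar (starRingEnd ℂ z) r :=
  ⟨Or.inl h₁, Or.inl ((edist_conj_right w z).trans_lt h₂)⟩

/-- The centres do not matter in the intersection of the discs about `z` and its conjugate. -/
theorem mem_ballStar_inter {z w : ℂ} {r : ℝ≥0∞} (h : z.im ≠ 0 ∨ 0 < r) :
    w ∈ ballStar z r ∩ ballStar (starRingEnd ℂ z) r ↔
      edist w z < r ∧ edist (starRingEnd ℂ w) z < r := by
  rw [← edist_conj_right]
  constructor
  · rintro ⟨h₁, h₂⟩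
    have hr : 0 < r := by
      rcases h with h | h
      · rcases h₁ with h₁ | rfl
        · exact zero_le.trans_lt h₁
        · rcases h₂ with h₂ | h₂
          · exact zero_le.trans_lt h₂
          · exact absurd (Complex.conj_eq_iff_im.1 (Eq.symm h₂)) h
      · exact h
    exact ⟨(mem_ballStar_of_pos hr).1 h₁, (mem_ballStar_of_pos hr).1 h₂⟩
  · rintro ⟨h₁, h₂⟩
    exact mem_ballStar_inter_of_lt h₁ ((edist_conj_right w z).symm.trans_lt h₂)

section balls

variable {I₀ p : Sedenion} {r : ℝ≥0∞} {q : SliceCone} {K : Sedenion} {w : ℂ}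

theorem mem_sigmaBall_of_both (hK : K ∈ sliceUnits) (hq : (q : Sedenion) = Ψ K w)
    (h₁ : edist w (zPt I₀ p) < r) (h₂ : edist (starRingEnd ℂ w) (zPt I₀ p) < r) :
    q ∈ sigmaBall I₀ p r :=
  Or.inl (Set.mem_iUnion₂.2 ⟨K, hK, w, mem_ballStar_inter_of_lt h₁ h₂, hq.symm⟩)

theorem mem_sigmaBall_of_unit (hq : (q : Sedenion) = Ψ (unitPt I₀ p) w)
    (h : w ∈ ballStar (zPt I₀ p) r) : q ∈ sigmaBall I₀ p r :=
  Or.inr ⟨w, h, hq.symm⟩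

theorem mem_hyperSigmaBall_of_both {m : ℕ} (J : Fin m → Sedenion) (hK : K ∈ sliceUnits)
    (hq : (q : Sedenion) = Ψ K w) (h₁ : edist w (zPt I₀ p) < r)
    (h₂ : edist (starRingEnd ℂ w) (zPt I₀ p) < r) : q ∈ hyperSigmaBall I₀ p r J :=
  Or.inl (Set.mem_iUnion₂.2 ⟨K, hK, w, mem_ballStar_inter_of_lt h₁ h₂, hq.symm⟩)

theorem mem_hyperSigmaBall_of_ker {m : ℕ} {J : Fin m → Sedenion} (hK : K ∈ unitsKer J)
    (hq : (q : Sedenion) = Ψ K w) (h : w ∈ ballStar (zPt I₀ p) r) :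
    q ∈ hyperSigmaBall I₀ p r J :=
  Or.inr (Set.mem_iUnion₂.2 ⟨K, hK, w, h, hq.symm⟩)

theorem sigmaBall_cases (hI : unitPt I₀ p ∈ sliceUnits) (h0 : (zPt I₀ p).im ≠ 0 ∨ 0 < r)
    (hq : q ∈ sigmaBall I₀ p r) :
    ∃ K ∈ sliceUnits, ∃ w : ℂ, (q : Sedenion) = Ψ K w ∧
      ((edist w (zPt I₀ p) < r ∧ edist (starRingEnd ℂ w) (zPt I₀ p) < r) ∨
        (K = unitPt I₀ p ∧ w ∈ ballStar (zPt I₀ p) r)) := by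
  rcases hq with hq | ⟨w, hw, hq⟩
  · obtain ⟨K, hK, w, hw, hq⟩ := Set.mem_iUnion₂.1 hq
    exact ⟨K, hK, w, hq.symm, Or.inl ((mem_ballStar_inter h0).1 hw)⟩
  · exact ⟨_, hI, w, hq.symm, Or.inr ⟨rfl, hw⟩⟩

theorem hyperSigmaBall_cases {m : ℕ} {J : Fin m → Sedenion} (h0 : (zPt I₀ p).im ≠ 0 ∨ 0 < r)
    (hq : q ∈ hyperSigmaBall I₀ p r J) :
    ∃ K ∈ sliceUnits, ∃ w : ℂ, (q : Sedenion) = Ψ K w ∧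
      ((edist w (zPt I₀ p) < r ∧ edist (starRingEnd ℂ w) (zPt I₀ p) < r) ∨
        (K ∈ unitsKer J ∧ w ∈ ballStar (zPt I₀ p) r)) := by
  rcases hq with hq | hq
  · obtain ⟨K, hK, w, hw, hq⟩ := Set.mem_iUnion₂.1 hq
    exact ⟨K, hK, w, hq.symm, Or.inl ((mem_ballStar_inter h0).1 hw)⟩
  · obtain ⟨K, hK, w, hw, hq⟩ := Set.mem_iUnion₂.1 hq
    exact ⟨K, hK.1, w, hq.symm, Or.inr ⟨hK, hw⟩⟩

/-- The points of the intersection of a hyper-`σ`-ball of radius `r` and a `σ`-ball of radius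
`s`. -/
theorem hyper_inter_sigma_cases {J : Sedenion} {s : ℝ≥0∞} (hI : unitPt I₀ p ∈ sliceUnits)
    (h0 : (zPt I₀ p).im ≠ 0) (hJ : agree (unitPt I₀ p) J ≠ ⊥)
    (hq : q ∈ hyperSigmaBall I₀ p r ![unitPt I₀ p, J] ∩ sigmaBall I₀ p s) :
    ∃ K ∈ sliceUnits, ∃ w : ℂ, (q : Sedenion) = Ψ K w ∧
      ((edist w (zPt I₀ p) < r ∧ edist (starRingEnd ℂ w) (zPt I₀ p) < r) ∨
        (K ∈ unitsKer ![unitPt I₀ p, J] ∧ w ∈ ballStar (zPt I₀ p) r ∧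
          (K = unitPt I₀ p ∨ edist (starRingEnd ℂ w) (zPt I₀ p) < s))) := by
  obtain ⟨K, hK, w, hw, h | ⟨hKJ, hwr⟩⟩ := hyperSigmaBall_cases (Or.inl h0) hq.1
  · exact ⟨K, hK, w, hw, Or.inl h⟩
  -- At a real point both discs are the same.
  by_cases hreal : w.im = 0
  · have hc : starRingEnd ℂ w = w := Complex.conj_eq_iff_im.2 hreal
    have h1 : edist w (zPt I₀ p) < r := by
      rcases hwr with h | rfl
      · exact h
      · exact absurd hreal h0
    exact ⟨K, hK, w, hw, Or.inl ⟨h1, by rwa [hc]⟩⟩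
  refine ⟨K, hK, w, hw, Or.inr ⟨hKJ, hwr, ?_⟩⟩
  obtain ⟨K', hK', w', hw', h⟩ := sigmaBall_cases hI (Or.inl h0) hq.2
  rcases Ψ_eq_iff hK hK' (hw.symm.trans hw') with ⟨rfl, hKK | h1⟩ | ⟨rfl, rfl⟩
  · rw [← hKK] at h
    rcases h with h | h
    · exact Or.inr h.2
    · exact Or.inl h.1
  · exact absurd h1 hreal
  · rcases h with h | h
    · exact Or.inr h.1
    · have hKI : K = -unitPt I₀ p := by rw [← h.1, neg_neg]
      exact absurd (hKI ▸ hKJ) (neg_not_mem_unitsKer hI hJ)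

end balls

/-! ### The domain of convergence -/

section domain

variable {I₀ : Sedenion} {p : SliceCone} {a : ℕ → Sedenion} {J : Sedenion} {q : SliceCone}

/-- For a real centre, the domain is a disc on each slice. -/
theorem mem_coneBall_iff {K : Sedenion} (hK : K ∈ sliceUnits) {z₀ w : ℂ} {r : ℝ≥0∞}
    (hp : (p : Sedenion) = Ψ K z₀) (hq : (q : Sedenion) = Ψ K w) :
    q ∈ coneBall p r ↔ w ∈ ballStar z₀ r := by
  change edist (q : Sedenion) p < r ∨ (q : Sedenion) = p ↔ edist w z₀ < r ∨ w = z₀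
  rw [hp, hq, edist_Ψ hK, (Ψ_injective hK).eq_iff]

/-- For a non-real centre, the domain consists of the points at which the holomorphic part and the
antiholomorphic part, reduced modulo the space on which the units agree, both converge. -/
theorem mem_sigmaDomain_iff (hI : unitPt I₀ p ∈ sliceUnits) (hp : ¬IsRealPt (p : Sedenion))
    (h0 : (zPt I₀ p).im ≠ 0) (hJ : J ∈ sliceUnits)
    (hJr : radiusAt I₀ p a J = radiusSup I₀ p a) :
    q ∈ sigmaDomain I₀ p a J ↔ ∃ K ∈ sliceUnits, ∃ w : ℂ, (q : Sedenion) = Ψ K w ∧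
      w ∈ ballStar (zPt I₀ p) (radius a) ∧
      edist (starRingEnd ℂ w) (zPt I₀ p) < perpRadius (unitPt I₀ p) a K := by
  have hle : radius a ≤ radiusSup I₀ p a := radius_le_radiusSup hJ a
  rw [sigmaDomain, if_neg hp]
  constructor
  · intro hq
    split_ifs at hq with hR
    · rw [hR] at hq
      obtain ⟨K, hK, w, hw, h | ⟨rfl, h⟩⟩ := sigmaBall_cases hI (Or.inl h0) hq
      · exact ⟨K, hK, w, hw, Or.inl h.1, h.2.trans_le (radius_le_perpRadius _ _ _)⟩
      · exact ⟨_, hI, w, hw, h, by rw [perpRadius_self]; exact edist_lt_top _ _⟩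
    · have hlt : radius a < radiusAt I₀ p a J := hJr ▸ lt_of_le_of_ne hle (Ne.symm hR)
      obtain ⟨-, -, hbot, hJp, -⟩ := large_radius hI hJ hlt
      obtain ⟨K, hK, w, hw, h | ⟨hKJ, h, rfl | h'⟩⟩ := hyper_inter_sigma_cases hI h0 hbot hq
      · exact ⟨K, hK, w, hw, Or.inl h.1, h.2.trans_le (radius_le_perpRadius _ _ _)⟩
      · exact ⟨_, hI, w, hw, h, by rw [perpRadius_self]; exact edist_lt_top _ _⟩
      · refine ⟨K, hK, w, hw, h, h'.trans_le ?_⟩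
        rw [← hJr, ← hJp]
        exact perpRadius_mono a (mem_unitsKer_pair.1 hKJ).2
  · rintro ⟨K, hK, w, hw, h₁, h₂⟩
    have hpos {R : ℝ≥0∞} (hR : radius a ≤ R) (h : perpRadius (unitPt I₀ p) a K ≤ R) :
        edist w (zPt I₀ p) < R := by
      rcases h₁ with h₁ | rfl
      · exact h₁.trans_le hR
      · rw [edist_self]
        exact (zero_le.trans_lt h₂).trans_le h
    by_cases hKI : unitPt I₀ p = K
    · have hw' : (q : Sedenion) = Ψ (unitPt I₀ p) w := by rw [hKI, hw]
      split_ifs with hR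
      · exact mem_sigmaBall_of_unit hw' (by rwa [hR])
      · exact ⟨mem_hyperSigmaBall_of_ker (self_mem_unitsKer hI) hw' h₁,
          mem_sigmaBall_of_unit hw' (h₁.imp (fun h => lt_of_lt_of_le h hle) id)⟩
    have hKR := perpRadius_le_radiusSup hp a hK hKI
    have hsig : q ∈ sigmaBall I₀ p (radiusSup I₀ p a) :=
      mem_sigmaBall_of_both hK hw (hpos hle hKR) (h₂.trans_le hKR)
    split_ifs with hR
    · exact hsig
    · have hlt : radius a < radiusAt I₀ p a J := hJr ▸ lt_of_le_of_ne hle (Ne.symm hR)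
      obtain ⟨-, -, -, -, hsmall⟩ := large_radius hI hJ hlt
      refine ⟨?_, hsig⟩
      by_cases hKJ : K ∈ unitsKer ![unitPt I₀ p, J]
      · exact mem_hyperSigmaBall_of_ker hKJ hw h₁
      · have h := hsmall K hK hKJ
        exact mem_hyperSigmaBall_of_both _ hK hw (hpos le_rfl h) (h₂.trans_le h)

theorem summable_of_mem_sigmaDomain (hI₀ : I₀ ∈ sliceUnits) (hJ : J ∈ sliceUnits)
    (hJr : radiusAt I₀ p a J = radiusSup I₀ p a) (hq : q ∈ sigmaDomain I₀ p a J) :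
    Summable fun n => ‖term p a n q‖ := by
  obtain ⟨hI, hpΨ, -, hreal⟩ := point_coordinates hI₀ p
  by_cases hp : IsRealPt (p : Sedenion)
  · obtain ⟨K, hK, w, -, hw⟩ := exists_Ψ q
    have hpK : (p : Sedenion) = Ψ K (zPt I₀ p) := by
      rw [Ψ_of_im_eq_zero (hreal.1 hp) K (unitPt I₀ p)]
      exact hpΨ
    rw [sigmaDomain, if_pos hp, mem_coneBall_iff hK hpK hw] at hq
    exact summable_term hK hK hpK hw hq (by rw [perpRadius_self]; exact edist_lt_top _ _)
  · obtain ⟨K, hK, w, hw, h₁, h₂⟩ :=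
      (mem_sigmaDomain_iff hI hp (fun h => hp (hreal.2 h)) hJ hJr).1 hq
    exact summable_term hI hK hpΨ hw h₁ h₂

theorem isOpen_setOf_edist_lt {f : ℂ → ℂ} (hf : Continuous f) (z₀ : ℂ) (r : ℝ≥0∞) :
    IsOpen {z | edist (f z) z₀ < r} :=
  isOpen_lt (by fun_prop) continuous_const

theorem sliceRegularOn_sigmaDomain (hI₀ : I₀ ∈ sliceUnits) (hJ : J ∈ sliceUnits)
    (hJr : radiusAt I₀ p a J = radiusSup I₀ p a) (ha : 0 < radius a) :
    SliceRegularOn (P p a) (sigmaDomain I₀ p a J) := by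
  obtain ⟨hI, hpΨ, -, hreal⟩ := point_coordinates hI₀ p
  by_cases hp : IsRealPt (p : Sedenion)
  · have hpK (K : sliceUnits) : (p : Sedenion) = Ψ K (zPt I₀ p) := by
      rw [Ψ_of_im_eq_zero (hreal.1 hp) K (unitPt I₀ p)]
      exact hpΨ
    have hmem (K : sliceUnits) (z : ℂ) :
        toCone K z ∈ sigmaDomain I₀ p a J ↔ edist z (zPt I₀ p) < radius a := by
      rw [sigmaDomain, if_pos hp, mem_coneBall_iff K.2 (hpK K) rfl, mem_ballStar_of_pos ha]
    refine ⟨fun K => ?_, fun K z hz => ?_⟩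
    · simp only [hmem]
      exact isOpen_setOf_edist_lt continuous_id _ _
    · exact regularAt_P K.2 K (hpK K) ((hmem K z).1 hz)
        (by rw [perpRadius_self]; exact edist_lt_top _ _)
  · have h0 : (zPt I₀ p).im ≠ 0 := fun h => hp (hreal.2 h)
    have hmem (K : sliceUnits) (z : ℂ) : toCone K z ∈ sigmaDomain I₀ p a J ↔
        (edist z (zPt I₀ p) < radius a ∧
          edist (starRingEnd ℂ z) (zPt I₀ p) < perpRadius (unitPt I₀ p) a K) ∨
        (edist (starRingEnd ℂ z) (zPt I₀ p) < radius a ∧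
          edist z (zPt I₀ p) < perpRadius (unitPt I₀ p) a (negUnit K)) := by
      rw [mem_sigmaDomain_iff hI hp h0 hJ hJr]
      constructor
      · rintro ⟨K', hK', w, hw, h₁, h₂⟩
        rw [mem_ballStar_of_pos ha] at h₁
        rcases Ψ_eq_iff K.2 hK' hw with ⟨rfl, hKK | hz⟩ | ⟨rfl, rfl⟩
        · rw [← hKK] at h₂
          exact Or.inl ⟨h₁, h₂⟩
        · refine Or.inl ⟨h₁, ?_⟩
          rw [Complex.conj_eq_iff_im.2 hz]
          exact h₁.trans_le (radius_le_perpRadius _ _ _)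
        · rw [Complex.conj_conj] at h₂
          exact Or.inr ⟨h₁, h₂⟩
      · rintro (⟨h₁, h₂⟩ | ⟨h₁, h₂⟩)
        · exact ⟨K, K.2, z, rfl, Or.inl h₁, h₂⟩
        · refine ⟨negUnit K, (negUnit K).2, starRingEnd ℂ z, (Ψ_neg_conj K.1 z).symm, Or.inl h₁, ?_⟩
          rwa [Complex.conj_conj]
    refine ⟨fun K => ?_, fun K z hz => ?_⟩
    · simp only [hmem]
      exact ((isOpen_setOf_edist_lt continuous_id _ _).inter
        (isOpen_setOf_edist_lt Complex.continuous_conj _ _)).union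
        ((isOpen_setOf_edist_lt Complex.continuous_conj _ _).inter
          (isOpen_setOf_edist_lt continuous_id _ _))
    · rcases (hmem K z).1 hz with ⟨h₁, h₂⟩ | ⟨h₁, h₂⟩
      · exact regularAt_P hI K hpΨ h₁ h₂
      · refine RegularAt.of_neg (regularAt_P hI (negUnit K) hpΨ h₁ ?_)
        rwa [Complex.conj_conj]

end domain

/-! ### Discs of the plane -/

theorem edist_lineMap_lt {w v z : ℂ} {r : ℝ≥0∞} (hw : edist w z ≤ r) (hv : edist v z < r)
    {t : ℝ} (ht0 : 0 < t) (ht1 : t ≤ 1) : edist (AffineMap.lineMap w v t) z < r := by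
  rcases eq_or_ne r ⊤ with rfl | hr
  · exact edist_lt_top _ _
  lift r to NNReal using hr
  rw [edist_nndist, ENNReal.coe_le_coe, ← NNReal.coe_le_coe, coe_nndist] at hw
  rw [edist_nndist, ENNReal.coe_lt_coe, ← NNReal.coe_lt_coe, coe_nndist] at *
  have h : AffineMap.lineMap w v t - z = ((1 - t : ℝ) : ℂ) * (w - z) + (t : ℂ) * (v - z) := by
    rw [AffineMap.lineMap_apply_module, Complex.real_smul, Complex.real_smul]
    push_cast
    ring
  rw [dist_eq_norm] at *
  rw [h]
  refine (norm_add_le _ _).trans_lt ?_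
  rw [norm_mul, norm_mul, Complex.norm_real, Complex.norm_real, Real.norm_of_nonneg ht0.le,
    Real.norm_of_nonneg (sub_nonneg.2 ht1)]
  have h1 := mul_le_mul_of_nonneg_left hw (sub_nonneg.2 ht1)
  have h2 := mul_lt_mul_of_pos_left hv ht0
  linarith

/-- If two open discs meet, then the closure of their intersection is the intersection of the closed
discs. -/
theorem mem_closure_of_edist_le {w v z₁ z₂ : ℂ} {r s : ℝ≥0∞} (hw₁ : edist w z₁ ≤ r)
    (hw₂ : edist w z₂ ≤ s) (hv₁ : edist v z₁ < r) (hv₂ : edist v z₂ < s) :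
    w ∈ closure {x : ℂ | edist x z₁ < r ∧ edist x z₂ < s} := by
  have hc : Tendsto (fun t : ℝ => AffineMap.lineMap w v t) (𝓝[>] 0) (𝓝 w) := by
    have h : Continuous fun t : ℝ => (AffineMap.lineMap w v t : ℂ) :=
      AffineMap.lineMap_continuous
    have := h.tendsto 0
    rw [AffineMap.lineMap_apply_zero] at this
    exact this.mono_left nhdsWithin_le_nhds
  refine mem_closure_of_tendsto hc ?_
  filter_upwards [Ioc_mem_nhdsGT (zero_lt_one' ℝ)] with t ht
  exact ⟨edist_lineMap_lt hw₁ hv₁ ht.1 ht.2, edist_lineMap_lt hw₂ hv₂ ht.1 ht.2⟩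

theorem edist_conj_self {z : ℂ} (hz : 0 < z.im) :
    edist (starRingEnd ℂ z) z = ENNReal.ofReal (2 * z.im) := by
  rw [edist_dist, Complex.dist_conj_self, abs_of_pos hz]

/-- Discs about `z` and its conjugate meet if the sum of the radii exceeds the distance. -/
theorem exists_mem_discs {z : ℂ} (hz : 0 < z.im) {r s : ℝ≥0∞} (hr : 0 < r) (hs : 0 < s)
    (h : ENNReal.ofReal (2 * z.im) < r + s) :
    ∃ v, edist v z < r ∧ edist v (starRingEnd ℂ z) < s := by
  by_cases hr' : ENNReal.ofReal (2 * z.im) < r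
  · exact ⟨starRingEnd ℂ z, by rwa [edist_conj_self hz], by rwa [edist_self]⟩
  by_cases hs' : ENNReal.ofReal (2 * z.im) < s
  · exact ⟨z, by rwa [edist_self], by rwa [edist_conj_right, edist_conj_self hz]⟩
  rw [not_lt] at hr' hs'
  lift r to NNReal using ne_top_of_le_ne_top ENNReal.ofReal_ne_top hr'
  lift s to NNReal using ne_top_of_le_ne_top ENNReal.ofReal_ne_top hs'
  have hd : 0 ≤ 2 * z.im := by positivity
  rw [← ENNReal.ofReal_coe_nnreal] at hr' hs'
  rw [ENNReal.ofReal_le_ofReal_iff hd] at hr' hs'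
  rw [← ENNReal.ofReal_coe_nnreal, ← ENNReal.ofReal_coe_nnreal (p := s),
    ← ENNReal.ofReal_add r.coe_nonneg s.coe_nonneg] at h
  have h' := ENNReal.ofReal_lt_ofReal_iff'.1 h |>.1
  have hr0 : (0 : ℝ) < r := by exact_mod_cast hr
  have hs0 : (0 : ℝ) < s := by exact_mod_cast hs
  -- The point on the segment from `z` to its conjugate halfway between the two circles.
  set x : ℝ := (2 * z.im - s + r) / 2 with hx
  refine ⟨z - (x : ℂ) * Complex.I, ?_, ?_⟩
  · rw [edist_dist, dist_eq_norm, sub_sub_cancel_left, norm_neg, norm_mul, Complex.norm_I, mul_one,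
      Complex.norm_real, ← ENNReal.ofReal_coe_nnreal, ENNReal.ofReal_lt_ofReal_iff hr0,
      Real.norm_eq_abs, abs_lt]
    constructor <;> linarith
  · have e : z - (x : ℂ) * Complex.I - starRingEnd ℂ z = ((2 * z.im - x : ℝ) : ℂ) * Complex.I := by
      apply Complex.ext
      · simp
      · simp; ring
    rw [edist_dist, dist_eq_norm, e, norm_mul, Complex.norm_I, mul_one,
      Complex.norm_real, ← ENNReal.ofReal_coe_nnreal, ENNReal.ofReal_lt_ofReal_iff hs0,
      Real.norm_eq_abs, abs_lt]
    constructor <;> linarith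

/-- The point of external tangency of discs about `z` and its conjugate. -/
theorem eq_tangency {z w : ℂ} (hz : 0 < z.im) {r s : ℝ≥0∞} (hw₁ : edist w z ≤ r)
    (hw₂ : edist w (starRingEnd ℂ z) ≤ s) (h : r + s = ENNReal.ofReal (2 * z.im)) :
    w = ⟨z.re, z.im - r.toReal⟩ := by
  have hr : r ≠ ⊤ := fun hr => by rw [hr, top_add] at h; exact ENNReal.ofReal_ne_top h.symm
  have hs : s ≠ ⊤ := fun hs => by rw [hs, add_top] at h; exact ENNReal.ofReal_ne_top h.symm
  have hrs : r.toReal + s.toReal = 2 * z.im := by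
    rw [← ENNReal.toReal_add hr hs, h, ENNReal.toReal_ofReal (by positivity)]
  have h₁ : dist w z ≤ r.toReal := by
    rw [dist_edist]; exact ENNReal.toReal_mono hr hw₁
  have h₂ : dist w (starRingEnd ℂ z) ≤ s.toReal := by
    rw [dist_edist]; exact ENNReal.toReal_mono hs hw₂
  rw [Complex.dist_eq] at h₁ h₂
  have i₁ := (abs_le.1 ((Complex.abs_im_le_norm _).trans h₁)).1
  have i₂ := (abs_le.1 ((Complex.abs_im_le_norm _).trans h₂)).2
  simp only [Complex.sub_im, Complex.conj_im] at i₁ i₂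
  have him : w.im = z.im - r.toReal := by linarith
  have hre : (w.re - z.re) * (w.re - z.re) = 0 := by
    have h3 := pow_le_pow_left₀ (norm_nonneg _) h₁ 2
    rw [Complex.sq_norm, Complex.normSq_apply, Complex.sub_re, Complex.sub_im, him] at h3
    nlinarith [mul_self_nonneg (w.re - z.re)]
  exact Complex.ext (by linarith [mul_self_eq_zero.1 hre]) him

/-! ### Divergence in the exterior -/

theorem continuous_toCone (K : sliceUnits) : Continuous (toCone K) :=
  ⟨fun _ hs => hs K⟩

theorem mem_closure_of_slice {K : sliceUnits} {q : SliceCone} {w : ℂ} {S : Set SliceCone}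
    {U : Set ℂ} (hq : (q : Sedenion) = Ψ K w) (hU : ∀ x ∈ U, toCone K x ∈ S)
    (hw : w ∈ closure U) : q ∈ closure S := by
  have : toCone K w = q := Subtype.ext hq.symm
  rw [← this]
  exact (continuous_toCone K).closure_preimage_subset S (closure_mono hU hw)

section exterior

variable {I₀ : Sedenion} {p : SliceCone} {a : ℕ → Sedenion} {J : Sedenion} {q : SliceCone}

theorem mem_closure_of_bounded_real (hI₀ : I₀ ∈ sliceUnits) (hp : IsRealPt (p : Sedenion))
    {M : ℝ} (hM : ∀ n, ‖term p a n q‖ ≤ M) : q ∈ closure (sigmaDomain I₀ p a J) := by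
  obtain ⟨hI, hpΨ, -, hreal⟩ := point_coordinates hI₀ p
  obtain ⟨K, hK, w, -, hw⟩ := exists_Ψ q
  have hpK : (p : Sedenion) = Ψ K (zPt I₀ p) := by
    rw [Ψ_of_im_eq_zero (hreal.1 hp) K (unitPt I₀ p)]
    exact hpΨ
  have hle := le_radius_of_bounded_same hK hpK hw hM
  have hmem {q : SliceCone} {w : ℂ} (hw : (q : Sedenion) = Ψ K w) :
      q ∈ sigmaDomain I₀ p a J ↔ w ∈ ballStar (zPt I₀ p) (radius a) := by
    rw [sigmaDomain, if_pos hp, mem_coneBall_iff hK hpK hw]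
  rcases eq_or_ne (radius a) 0 with hr | hr
  · rw [hr, nonpos_iff_eq_zero, edist_eq_zero] at hle
    exact subset_closure ((hmem hw).2 (Or.inr hle))
  · have hv : edist (zPt I₀ p) (zPt I₀ p) < radius a := by
      rw [edist_self]; exact pos_iff_ne_zero.2 hr
    exact mem_closure_of_slice (K := ⟨K, hK⟩) hw (fun x hx => (hmem rfl).2 (Or.inl hx.1))
      (mem_closure_of_edist_le hle hle hv hv)

/-- If the terms are bounded at a point which is not one of external tangency, then the point is in
the closure of the domain. -/
theorem mem_closure_of_bounded (hI₀ : I₀ ∈ sliceUnits) (hp : ¬IsRealPt (p : Sedenion))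
    (hJ : J ∈ sliceUnits) (hJr : radiusAt I₀ p a J = radiusSup I₀ p a)
    {M : ℝ} (hM : ∀ n, ‖term p a n q‖ ≤ M) (hq : q ∉ tangencyPoints I₀ p a J) :
    q ∈ closure (sigmaDomain I₀ p a J) := by
  obtain ⟨hI, hpΨ, him, hreal⟩ := point_coordinates hI₀ p
  have him0 : (zPt I₀ p).im ≠ 0 := fun h => hp (hreal.2 h)
  have hpos : 0 < (zPt I₀ p).im := lt_of_le_of_ne him him0.symm
  have hmem {K : Sedenion} (hK : K ∈ sliceUnits) {q : SliceCone} {w : ℂ}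
      (hw : (q : Sedenion) = Ψ K w) (h₁ : w ∈ ballStar (zPt I₀ p) (radius a))
      (h₂ : edist (starRingEnd ℂ w) (zPt I₀ p) < perpRadius (unitPt I₀ p) a K) :
      q ∈ sigmaDomain I₀ p a J :=
    (mem_sigmaDomain_iff hI hp him0 hJ hJr).2 ⟨K, hK, w, hw, h₁, h₂⟩
  have htop (w : ℂ) : edist w (zPt I₀ p) < perpRadius (unitPt I₀ p) a (unitPt I₀ p) := by
    rw [perpRadius_self]; exact edist_lt_top _ _
  obtain ⟨K, hK, w, hw0, hw⟩ := exists_Ψ q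
  by_cases hsame : K = unitPt I₀ p ∨ w.im = 0
  · have hw' : (q : Sedenion) = Ψ (unitPt I₀ p) w := by
      rcases hsame with h | h
      · rw [← h, hw]
      · rw [hw]; exact Ψ_of_im_eq_zero h _ _
    have hle := le_radius_of_bounded_same hI hpΨ hw' hM
    rcases eq_or_ne (radius a) 0 with hr | hr
    · rw [hr, nonpos_iff_eq_zero, edist_eq_zero] at hle
      exact subset_closure (hmem hI hw' (Or.inr hle) (htop _))
    · have hv : edist (zPt I₀ p) (zPt I₀ p) < radius a := by
        rw [edist_self]; exact pos_iff_ne_zero.2 hr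
      exact mem_closure_of_slice (K := ⟨_, hI⟩) hw'
        (fun x hx => hmem hI rfl (Or.inl hx.1) (htop _))
        (mem_closure_of_edist_le hle hle hv hv)
  obtain ⟨hKI, hwne⟩ := not_or.1 hsame
  have hwpos : 0 < w.im := lt_of_le_of_ne hw0 (Ne.symm hwne)
  have hlt : dist w (zPt I₀ p) < dist (starRingEnd ℂ w) (zPt I₀ p) := by
    rw [Complex.dist_eq, Complex.dist_eq]
    refine lt_of_pow_lt_pow_left₀ 2 (norm_nonneg _) ?_
    rw [Complex.sq_norm, Complex.sq_norm, Complex.normSq_apply, Complex.normSq_apply]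
    simp only [Complex.sub_re, Complex.sub_im, Complex.conj_re, Complex.conj_im]
    nlinarith [mul_pos hwpos hpos]
  obtain ⟨h₁, h₂⟩ := le_radius_of_bounded hI hK hpΨ hw hM hlt
  set ρ := perpRadius (unitPt I₀ p) a K with hρ
  have h₂' : edist w (starRingEnd ℂ (zPt I₀ p)) ≤ ρ := by rwa [edist_conj_right]
  have htri : ENNReal.ofReal (2 * (zPt I₀ p).im) ≤ radius a + ρ := by
    rw [← edist_conj_self hpos, edist_comm]
    refine (edist_triangle_left _ _ w).trans (add_le_add h₁ h₂')
  rcases htri.eq_or_lt with heq | hltsum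
  · -- The discs touch externally. Equal radii would put the point of tangency on the real axis.
    have hwt := eq_tangency hpos h₁ h₂' heq.symm
    have hRρ : radius a < ρ := by
      by_contra hnot
      rw [not_lt] at hnot
      have hρR : ρ = radius a := le_antisymm hnot (radius_le_perpRadius _ _ _)
      rw [hρR] at heq
      have h3 := congrArg ENNReal.toReal heq
      have hne : radius a ≠ ⊤ := fun h => by
        rw [h, top_add] at heq; exact ENNReal.ofReal_ne_top heq
      rw [ENNReal.toReal_ofReal (by positivity), ENNReal.toReal_add hne hne] at h3
      rw [hwt] at hwpos
      simp only at hwpos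
      linarith
    have hρs : ρ ≤ radiusSup I₀ p a := perpRadius_le_radiusSup hp a hK (Ne.symm hKI)
    have hlt' : radius a < radiusAt I₀ p a J := hJr ▸ hRρ.trans_le hρs
    obtain ⟨-, -, -, hJp, hsmall⟩ := large_radius hI hJ hlt'
    have hKJ : K ∈ unitsKer ![unitPt I₀ p, J] := by
      by_contra hKJ
      exact hRρ.not_ge (hsmall K hK hKJ)
    have hρe : ρ = radiusSup I₀ p a := by
      refine le_antisymm hρs ?_
      rw [← hJr, ← hJp]
      exact perpRadius_mono a (mem_unitsKer_pair.1 hKJ).2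
    refine absurd ⟨hρe ▸ hRρ, ?_, K, hKJ, ?_⟩ hq
    · rw [← hρe, ← heq]
      rfl
    · rw [hw, hwt]
      rfl
  rcases eq_or_ne (radius a) 0 with hr | hr
  · rw [hr, nonpos_iff_eq_zero, edist_eq_zero] at h₁
    refine subset_closure (hmem hK hw (Or.inr h₁) ?_)
    rw [h₁, edist_conj_self hpos]
    rwa [hr, zero_add] at hltsum
  · have hr' : 0 < radius a := pos_iff_ne_zero.2 hr
    obtain ⟨v, hv₁, hv₂⟩ := exists_mem_discs hpos hr'
      (hr'.trans_le (radius_le_perpRadius _ _ _)) hltsum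
    refine mem_closure_of_slice (K := ⟨K, hK⟩) hw (fun x hx => ?_)
      (mem_closure_of_edist_le h₁ h₂' hv₁ hv₂)
    exact hmem hK rfl (Or.inl hx.1) (by rw [← edist_conj_right]; exact hx.2)

end exterior

/-! ### Uniform convergence -/

section uniform

variable {I₀ : Sedenion} {p : SliceCone} {a : ℕ → Sedenion} {J : Sedenion} {q : SliceCone}

theorem continuous_of_slices {X : Type*} [TopologicalSpace X] {f : SliceCone → X}
    (h : ∀ K, Continuous fun w => f (toCone K w)) : Continuous f :=
  ⟨fun _ hs K => hs.preimage (h K)⟩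

theorem continuous_apply_add_apply {X V : Type*} [TopologicalSpace X] [NormedAddCommGroup V]
    [NormedSpace ℝ V] (A B : V →L[ℝ] V) (f' g' : ℂ →L[ℝ] V) {f g : X → ℂ} (hf : Continuous f)
    (hg : Continuous g) : Continuous fun x => A (f' (f x)) + B (g' (g x)) := by
  fun_prop

theorem continuous_term (p : SliceCone) (a : ℕ → Sedenion) (n : ℕ) :
    Continuous (term p a n) := by
  obtain ⟨I, hI, z₀, -, hp⟩ := exists_Ψ p
  refine continuous_of_slices fun K => ?_
  have h (w : ℂ) := term_eq hI K.2 hp (q := toCone K w) (w := w) rfl a n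
  simp only [h]
  have c₁ : Continuous fun w : ℂ => (w - z₀) ^ n := by fun_prop
  have c₂ : Continuous fun w : ℂ => (starRingEnd ℂ w - z₀) ^ n := by fun_prop
  simp only [← opCLM_apply (holoPart I _), ← opCLM_apply (antiPart I _), ← actCLM_apply]
  exact continuous_apply_add_apply _ _ _ _ c₁ c₂

/-- The Weierstrass test. Since the terms are continuous in the slice topology, bounds on a set hold
on its closure. -/
theorem tendstoUniformlyOn_closure {S : Set SliceCone} {u : ℕ → ℝ} (hu : Summable u)
    (h : ∀ q ∈ S, ∀ n, ‖term p a n q‖ ≤ u n) :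
    TendstoUniformlyOn (partialSum p a) (P p a) atTop (closure S) := by
  refine tendstoUniformlyOn_tsum_nat hu fun n q hq => ?_
  have hcl : IsClosed {q | ‖term p a n q‖ ≤ u n} :=
    isClosed_le (continuous_term p a n).norm continuous_const
  exact closure_minimal (fun q hq => h q hq n) hcl hq

theorem norm_term_le_of_dist_le {I K : Sedenion} (hI : I ∈ sliceUnits) (hK : K ∈ sliceUnits)
    {z₀ w : ℂ} (hp : (p : Sedenion) = Ψ I z₀) (hq : (q : Sedenion) = Ψ K w) {s t e : ℝ}
    (hs : 0 ≤ s) (h₁ : dist w z₀ ≤ t) (h₂ : K = I ∨ dist (starRingEnd ℂ w) z₀ ≤ s) {n : ℕ}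
    (he : ‖perp I K (a n)‖ ≤ e) : ‖term p a n q‖ ≤ t ^ n * ‖a n‖ + s ^ n * e := by
  have he0 : 0 ≤ e := (norm_nonneg _).trans he
  refine (norm_term_le hI hK hp hq a n).trans (add_le_add (by gcongr) ?_)
  rcases h₂ with rfl | h₂
  · rw [perp_self, norm_zero, mul_zero]
    positivity
  · gcongr

theorem dist_le_of_edist_lt {w z : ℂ} {r : ℝ≥0∞} (hr : r ≠ ⊤) (h : edist w z < r) :
    dist w z ≤ r.toReal := by
  rw [dist_edist]
  exact ENNReal.toReal_mono hr h.le

theorem summable_toReal {u : ℕ → ℝ} (hu : ∀ n, 0 ≤ u n) {r : ℝ≥0∞} (hr : r < rootRadius u) :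
    Summable fun n => r.toReal ^ n * u n :=
  summable_of_lt_rootRadius hu ENNReal.toReal_nonneg
    (by rwa [ENNReal.ofReal_toReal hr.ne_top])

theorem tendstoUniformlyOn_sigmaBall (hI₀ : I₀ ∈ sliceUnits) {r : ℝ≥0∞} (hr0 : 0 < r)
    (hr : r < radius a) :
    TendstoUniformlyOn (partialSum p a) (P p a) atTop (closure (sigmaBall I₀ p r)) := by
  obtain ⟨hI, hpΨ, -, -⟩ := point_coordinates hI₀ p
  have hs := summable_toReal (fun n => norm_nonneg (a n)) hr
  refine tendstoUniformlyOn_closure (hs.add hs) fun q hq n => ?_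
  obtain ⟨K, hK, w, hw, h⟩ := sigmaBall_cases hI (Or.inr hr0) hq
  rw [mem_ballStar_of_pos hr0] at h
  refine norm_term_le_of_dist_le hI hK hpΨ hw ENNReal.toReal_nonneg ?_ ?_ (norm_perp_le _ _ _)
  · exact dist_le_of_edist_lt hr.ne_top (h.elim And.left And.right)
  · exact h.symm.imp And.left fun h => dist_le_of_edist_lt hr.ne_top h.2

theorem tendstoUniformlyOn_coneBall (hI₀ : I₀ ∈ sliceUnits) (hp : IsRealPt (p : Sedenion))
    {r : ℝ≥0∞} (hr0 : 0 < r) (hr : r < radius a) :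
    TendstoUniformlyOn (partialSum p a) (P p a) atTop (closure (coneBall p r)) := by
  obtain ⟨hI, hpΨ, -, hreal⟩ := point_coordinates hI₀ p
  refine tendstoUniformlyOn_closure (summable_toReal (fun n => norm_nonneg (a n)) hr)
    fun q hq n => ?_
  obtain ⟨K, hK, w, -, hw⟩ := exists_Ψ q
  have hpK : (p : Sedenion) = Ψ K (zPt I₀ p) := by
    rw [Ψ_of_im_eq_zero (hreal.1 hp) K (unitPt I₀ p)]
    exact hpΨ
  rw [mem_coneBall_iff hK hpK hw, mem_ballStar_of_pos hr0] at hq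
  rw [norm_term_same hK hpK hw]
  have := dist_le_of_edist_lt hr.ne_top hq
  gcongr

theorem tendstoUniformlyOn_hyper (hI₀ : I₀ ∈ sliceUnits) (hJ : J ∈ sliceUnits)
    (hlt : radius a < radiusAt I₀ p a J) {r s : ℝ≥0∞} (hr0 : 0 < r) (hr : r < radius a)
    (hs : s < radiusAt I₀ p a J ∨ radiusAt I₀ p a J = ⊤) :
    TendstoUniformlyOn (partialSum p a) (P p a) atTop
      (closure (hyperSigmaBall I₀ p r ![unitPt I₀ p, J] ∩ sigmaBall I₀ p s)) := by
  obtain ⟨hI, hpΨ, -, hreal⟩ := point_coordinates hI₀ p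
  obtain ⟨hp, -, hbot, hJp, -⟩ := large_radius hI hJ hlt
  have h0 : (zPt I₀ p).im ≠ 0 := fun h => hp (hreal.2 h)
  -- In the case of an infinite second radius, the first disc bounds the distance.
  obtain ⟨σ, hσ, hσs⟩ : ∃ σ : ℝ≥0∞, σ < radiusAt I₀ p a J ∧
      ∀ w : ℂ, edist w (zPt I₀ p) < r → edist (starRingEnd ℂ w) (zPt I₀ p) < s →
        edist (starRingEnd ℂ w) (zPt I₀ p) ≤ σ := by
    rcases hs with hs | hs
    · exact ⟨s, hs, fun w _ h => h.le⟩
    · refine ⟨r + edist (starRingEnd ℂ (zPt I₀ p)) (zPt I₀ p), ?_, fun w h _ => ?_⟩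
      · rw [hs]
        exact ENNReal.add_lt_top.2 ⟨hr.trans_le le_top, edist_lt_top _ _⟩
      · refine (edist_triangle _ (starRingEnd ℂ (zPt I₀ p)) _).trans (add_le_add ?_ le_rfl)
        rw [edist_conj_right, Complex.conj_conj]
        exact h.le
  have s₁ := summable_toReal (fun n => norm_nonneg (a n)) hr
  have s₂ := summable_toReal (fun n => norm_nonneg (perp (unitPt I₀ p) J (a n)))
    (hσ.trans_eq hJp.symm)
  refine tendstoUniformlyOn_closure ((s₁.add s₁).add s₂) fun q hq n => ?_
  have n₁ : 0 ≤ r.toReal ^ n * ‖a n‖ := by positivity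
  have n₂ : 0 ≤ σ.toReal ^ n * ‖perp (unitPt I₀ p) J (a n)‖ := by positivity
  obtain ⟨K, hK, w, hw, h | ⟨hKJ, h, h'⟩⟩ := hyper_inter_sigma_cases hI h0 hbot hq
  · have := norm_term_le_of_dist_le hI hK hpΨ hw (a := a) (n := n) ENNReal.toReal_nonneg
      (dist_le_of_edist_lt hr.ne_top h.1) (Or.inr (dist_le_of_edist_lt hr.ne_top h.2))
      (norm_perp_le _ _ _)
    linarith
  · rw [mem_ballStar_of_pos hr0] at h
    have := norm_term_le_of_dist_le hI hK hpΨ hw (a := a) (n := n) (s := σ.toReal)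
      ENNReal.toReal_nonneg (dist_le_of_edist_lt hr.ne_top h)
      (h'.imp id fun h' => by
        rw [dist_edist]
        exact ENNReal.toReal_mono hσ.ne_top (hσs w h h'))
      (norm_perp_anti (mem_unitsKer_pair.1 hKJ).2 _)
    linarith

end uniform

end SedenionSeries

open SedenionSeries in
theorem theorem2 (I₀ : Sedenion) (hI₀ : I₀ ∈ sliceUnits) (p : SliceCone) (a : ℕ → Sedenion) :
    (∃ J ∈ sliceUnits, radiusAt I₀ p a J = radiusSup I₀ p a) ∧
    ∀ J ∈ sliceUnits, radiusAt I₀ p a J = radiusSup I₀ p a →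
      (radius a < radiusSup I₀ p a → IsHyperSolution ![unitPt I₀ p, J]) ∧
      (∀ q ∈ sigmaDomain I₀ p a J, Summable fun n => ‖term p a n q‖) ∧
      (0 < radius a → SliceRegularOn (P p a) (sigmaDomain I₀ p a J)) ∧
      (∀ q ∈ interior (sigmaDomain I₀ p a J)ᶜ, q ∉ tangencyPoints I₀ p a J →
        ¬ ∃ s : Sedenion, Tendsto (fun N => partialSum p a N q) atTop (𝓝 s)) ∧
      (∀ ε : ℝ≥0∞, 0 < ε → ε < radius a →
        (radius a = ⊤ →
          TendstoUniformlyOn (partialSum p a) (P p a) atTop (closure (sigmaBall I₀ p ε))) ∧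
        (radius a ≠ ⊤ →
          TendstoUniformlyOn (partialSum p a) (P p a) atTop
            (closure (sigmaShrunk I₀ p a J ε)))) := by
  have hI := (point_coordinates hI₀ p).1
  refine ⟨exists_radiusAt_eq_radiusSup hI₀ hI a, fun J hJ hJr =>
    ⟨fun hlt => ?_, fun q hq => summable_of_mem_sigmaDomain hI₀ hJ hJr hq,
      sliceRegularOn_sigmaDomain hI₀ hJ hJr, fun q hq hqt hconv => ?_,
      fun ε hε0 hε => ⟨fun _ => tendstoUniformlyOn_sigmaBall hI₀ hε0 hε, fun hfin => ?_⟩⟩⟩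
  · obtain ⟨-, hne, hbot, -⟩ := large_radius hI hJ (hJr ▸ hlt)
    exact isHyperSolution_pair hI hJ hne hbot
  · rw [interior_compl] at hq
    obtain ⟨M, hM⟩ := exists_bound_of_tendsto hconv
    by_cases hp : IsRealPt (p : Sedenion)
    · exact hq (mem_closure_of_bounded_real hI₀ hp hM)
    · exact hq (mem_closure_of_bounded hI₀ hp hJ hJr hM hqt)
  · have hr0 : 0 < radius a - ε := tsub_pos_of_lt hε
    have hr : radius a - ε < radius a :=
      ENNReal.sub_lt_self hfin (hε0.trans hε).ne' hε0.ne'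
    rw [sigmaShrunk]
    split_ifs with hp hR
    · exact tendstoUniformlyOn_coneBall hI₀ hp hr0 hr
    · rw [hR]
      exact tendstoUniformlyOn_sigmaBall hI₀ hr0 hr
    · have hlt : radius a < radiusAt I₀ p a J :=
        hJr ▸ lt_of_le_of_ne (radius_le_radiusSup hJ a) (Ne.symm hR)
      refine tendstoUniformlyOn_hyper hI₀ hJ hlt hr0 hr ?_
      rw [← hJr]
      by_cases htop : radiusAt I₀ p a J = ⊤
      · exact Or.inr htop
      · exact Or.inl (ENNReal.sub_lt_self htop (hε0.trans (hε.trans hlt)).ne' hε0.ne')
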